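/- Let $R$ be a commutative ring, let $A=\mathbb D^2\setminus\{*\}$ be an annulus, let $L\subset A\times[0,1]$ be an oriented link, and let $D\subset A$ be any diagram of $L$ with any ordering of its crossings. Let $\mathrm{CKh}(D)=\bigoplus_{i,j}\mathrm{CKh}^{i,j}(D)$ be the Khovanov complex over $R$ of $D$ viewed as a planar diagram ($i$ the homological and $j$ the quantum grading), generated by the enhanced states $x=\{(C_l,s_l)\}_l$ (a complete resolution of $D$ into circles $C_l$ with signs $s_l=\pm1$), and put $k(x)=\sum_l s_l[C_l]\in H_1(A;\mathbb Z)=\mathbb Z$, where the circles are oriented counterclockwise, so that $[C_l]$ is $1$ if $C_l$ encloses the puncture and $0$ otherwise. Let $F_k\,\mathrm{CKh}(D)$ be the span of the generators $x$ with $k(x)\le k$. Then the Khovanov differential $d$ satisfies $d^2=0$ and respects the filtration $F$. Write $$\mathrm{Kh}^{i,j}(L)=H^i(\mathrm{CKh}^{*,j}(D)),\qquad \mathrm{AKh}^{i,j,k}(L)=H^i\bigl(F_k\,\mathrm{CKh}^{*,j}(D)/F_{k-1}\,\mathrm{CKh}^{*,j}(D)\bigr),$$ and let $F_k\,\mathrm{Kh}^{i,j}(L)$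 be the set of classes in $\mathrm{Kh}^{i,j}(L)$ that have a representative in $F_k\,\mathrm{CKh}^{i,j}(D)$. Then there is a spectral sequence $(E_r,d_r)_{r\ge1}$ of $\mathbb Z^3$-graded $R$-modules, with $d_r$ of degree $(1,0,-r)$, such that $$E_1^{i,j,k}\cong \mathrm{AKh}^{i,j,k}(L)\quad\text{for all } i,j,k,$$ and which converges to $\mathrm{Kh}(L)$: the filtration $F$ of each $\mathrm{Kh}^{i,j}(L)$ is bounded (zero for small $k$, everything for large $k$), and there is an $N\ge 1$ such that, for all $r\ge N$, $d_r=0$ and $$E_r^{i,j,k}\cong F_k\,\mathrm{Kh}^{i,j}(L)/F_{k-1}\,\mathrm{Kh}^{i,j}(L)\quad\text{for all } i,j,k.$$ -/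

import Mathlib

open CategoryTheory

universe u

noncomputable section

/-! ### Annular link diagrams -/

/-- The half-edges (darts) of a plane graph with `n` crossings and `m` marked points.
`Sum.inl (c, i)` are the four half-edges at the crossing `c`, listed counterclockwise, such that
`i = 0, 2` belong to the under-strand and `i = 1, 3` to the over-strand.
`Sum.inr (p, b)` are the two half-edges at the marked point `p`. -/
abbrev Dart (n m : ℕ) : Type := (Fin n × ZMod 4) ⊕ (Fin m × Bool)

/-- The next half-edge, counterclockwise, at the same vertex. -/
def Dart.rot {n m : ℕ} : Dart n m → Dart n m
  | Sum.inl (c, i) => Sum.inl (c, i + 1)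
  | Sum.inr (p, b) => Sum.inr (p, !b)

/-- An oriented link diagram in the annulus `A = 𝔻² \ {*}`, up to planar isotopy, as a combinatorial
plane graph. The vertices are the crossings, which are 4-valent and come in a fixed order, and
marked points, which are 2-valent; the latter allow closed components without crossings. The
diagram may be disconnected or empty, and the complementary regions need not be discs. -/
structure AnnularDiagram where
  /-- the number of crossings -/
  n : ℕ
  /-- the number of marked points -/
  m : ℕ
  /-- the half-edge at the other end of the same edge -/
  edge : Dart n m → Dart n m
  edge_edge : ∀ d, edge (edge d) = d
  /-- whether the orientation of the link points away from the vertex along this half-edge -/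
  out : Dart n m → Bool
  out_edge : ∀ d, out (edge d) = !(out d)
  out_crossing : ∀ c i, out (Sum.inl (c, i + 2)) = !(out (Sum.inl (c, i)))
  out_point : ∀ p b, out (Sum.inr (p, !b)) = !(out (Sum.inr (p, b)))
  /-- the number of connected components of the complement of the diagram in the plane -/
  numRegions : ℕ
  /-- `region d` is the region on the left of `d`, looking away from the vertex; near the vertex it
  is the sector between `d` and `d.rot` -/
  region : Dart n m → Fin numRegions
  region_edge_rot : ∀ d, region (edge d.rot) = region d
  /-- one can get from any region to any other by crossing edges -/
  region_connected : ∀ r r', Relation.EqvGen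
    (fun a b => ∃ d, a = region d ∧ b = region (edge d)) r r'
  /-- planarity, by Euler's formula `V - E + F = 1 + C` with `V = n + m`, `E = 2 * n + m`,
  `F` the number of regions and `C` the number of connected components of the graph -/
  euler : n + m + numRegions =
    (2 * n + m) + 1 + Nat.card (Quot fun d d' : Dart n m => d' = edge d ∨ d' = d.rot)
  /-- the region that contains the puncture `*` of the annulus -/
  puncture : Fin numRegions
  /-- the region next to the outer boundary circle of the annulus -/
  outer : Fin numRegions

namespace AnnularDiagram

variable (D : AnnularDiagram)

/-- A crossing is positive if, seen along the oriented under-strand, the over-strand passes from left to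
right; equivalently, exactly one of the neighbouring half-edges `0`, `1` is outgoing. -/
def IsPositive (c : Fin D.n) : Prop :=
  D.out (Sum.inl (c, 0)) ≠ D.out (Sum.inl (c, 1))

/-- `n₊` -/
def nPos : ℕ := Nat.card {c : Fin D.n // D.IsPositive c}

/-- `n₋` -/
def nNeg : ℕ := Nat.card {c : Fin D.n // ¬ D.IsPositive c}

/-- The writhe `n₊ - n₋`. -/
def writhe : ℤ := D.nPos - D.nNeg

/-! ### Resolutions and enhanced states -/

/-- A choice of `0`-resolution (`false`) or `1`-resolution (`true`) for every crossing. -/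
abbrev Resolution : Type := Fin D.n → Bool

variable {D}

/-- How half-edges are joined at the vertices in the resolved diagram. The `0`-resolution of a
crossing joins the two regions that the over-strand sweeps when it is turned counterclockwise, so it
joins the half-edges `0, 1` and `2, 3`; the `1`-resolution joins `0, 3` and `1, 2`. -/
def smooth (S : D.Resolution) : Dart D.n D.m → Dart D.n D.m
  | Sum.inl (c, i) => Sum.inl (c, if S c then 3 - i else 1 - i)
  | Sum.inr (p, b) => Sum.inr (p, !b)

/-- The circles of the resolved diagram `D(S)`. -/
def Circle (S : D.Resolution) : Type :=
  Quot fun d d' : Dart D.n D.m => d' = D.edge d ∨ d' = smooth S d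

/-- The circle of `D(S)` through a half-edge. -/
def circleOf (S : D.Resolution) (d : Dart D.n D.m) : Circle S := Quot.mk _ d

instance (S : D.Resolution) : Finite (Circle S) :=
  Finite.of_surjective (circleOf S) Quot.mk_surjective

instance (S : D.Resolution) : Fintype (Circle S) := Fintype.ofFinite _

/-- The circle `C` encloses the puncture: there is a set `U` of regions (those inside `C`) which
contains the puncture but not the outer boundary, such that the edges with one side in `U` and
the other one not in `U` are precisely those of `C`. -/
def Circle.EnclosesPuncture {S : D.Resolution} (C : Circle S) : Prop :=
  ∃ U : Set (Fin D.numRegions), D.puncture ∈ U ∧ D.outer ∉ U ∧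
    ∀ d, Xor (D.region d ∈ U) (D.region (D.edge d) ∈ U) ↔ circleOf S d = C

open Classical in
/-- The class `[C] ∈ H₁(A; ℤ) = ℤ` of a circle (a simple closed curve, oriented
counterclockwise): `1` if it encloses the puncture and `0` otherwise. -/
def Circle.homologyClass {S : D.Resolution} (C : Circle S) : ℤ :=
  if C.EnclosesPuncture then 1 else 0

variable (D)

/-- An enhanced state: a resolution with a sign (`true` for `v₊`, `false` for `v₋`) on every
circle. These are the generators of the Khovanov complex. -/
abbrev EnhancedState : Type := Σ S : D.Resolution, (Circle S → Bool)

variable {D}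

/-- The sign as an integer. -/
def signValue (b : Bool) : ℤ := if b then 1 else -1

namespace EnhancedState

/-- The number `|S|` of `1`-resolutions. -/
def height (x : D.EnhancedState) : ℕ := Nat.card {c : Fin D.n // x.1 c = true}

/-- The homological grading `|S| - n₋`. -/
def homDeg (x : D.EnhancedState) : ℤ := x.height - D.nNeg

/-- The quantum grading: `v₊`, `v₋` have degrees `1`, `-1`, shifted by `|S| - n₋ + writhe`. -/
def qDeg (x : D.EnhancedState) : ℤ :=
  ∑ C : Circle x.1, signValue (x.2 C) + (x.height - D.nNeg + D.writhe)

/-- The annular grading `k(x) = ∑ sᵢ [Cᵢ]`. -/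
def annDeg (x : D.EnhancedState) : ℤ :=
  ∑ C : Circle x.1, signValue (x.2 C) * C.homologyClass

/-- The sign of the circle through a half-edge. -/
def sign (x : D.EnhancedState) (d : Dart D.n D.m) : Bool := x.2 (circleOf x.1 d)

/-- Whether only one circle passes through what is left of the crossing `c`. -/
def OneCircleAt (x : D.EnhancedState) (c : Fin D.n) : Prop :=
  circleOf x.1 (Sum.inl (c, 0)) = circleOf x.1 (Sum.inl (c, 2))

end EnhancedState

/-- `MulRule a b r`: the generator `r` occurs in `m (a ⊗ b)`, where
`m (v₊ ⊗ v₊) = v₊`, `m (v₊ ⊗ v₋) = m (v₋ ⊗ v₊) = v₋`, `m (v₋ ⊗ v₋) = 0`. -/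
def MulRule : Bool → Bool → Bool → Prop
  | true, true, r => r = true
  | true, false, r => r = false
  | false, true, r => r = false
  | false, false, _ => False

/-- `ComulRule a r s`: the generator `r ⊗ s` occurs in `Δ a`, where
`Δ v₊ = v₊ ⊗ v₋ + v₋ ⊗ v₊`, `Δ v₋ = v₋ ⊗ v₋`. -/
def ComulRule : Bool → Bool → Bool → Prop
  | true, r, s => r ≠ s
  | false, r, s => r = false ∧ s = false

/-- The generator `y` occurs in the image of the generator `x` under the map `d_{S,S'}`, where
`S'` is obtained from `S` by changing the resolution of the crossing `c` from `0` to `1`: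
the circles away from `c` keep their signs, and at `c` two circles are merged by `m` or one circle
is split by `Δ`. -/
def Occurs (c : Fin D.n) (x y : D.EnhancedState) : Prop :=
  x.1 c = false ∧ y.1 = Function.update x.1 c true ∧
  (∀ d, circleOf x.1 d ≠ circleOf x.1 (Sum.inl (c, 0)) →
    circleOf x.1 d ≠ circleOf x.1 (Sum.inl (c, 2)) → y.sign d = x.sign d) ∧
  ((¬ x.OneCircleAt c ∧ y.OneCircleAt c ∧
      MulRule (x.sign (Sum.inl (c, 0))) (x.sign (Sum.inl (c, 2))) (y.sign (Sum.inl (c, 0)))) ∨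
    (x.OneCircleAt c ∧ ¬ y.OneCircleAt c ∧
      ComulRule (x.sign (Sum.inl (c, 0))) (y.sign (Sum.inl (c, 0))) (y.sign (Sum.inl (c, 2)))))

open Classical in
/-- The coefficient of `y` in the Khovanov differential of `x`. The sign for changing the
crossing `c` is `(-1)` to the number of `1`-resolutions before `c`. -/
def diffCoeff (R : Type u) [CommRing R] (x y : D.EnhancedState) : R :=
  ∑ c : Fin D.n,
    if Occurs c x y then (-1) ^ (Nat.card {i : Fin D.n // i < c ∧ x.1 i = true}) else 0

/-! ### The Khovanov complex and its annular filtration -/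

variable (D)

/-- The generators in homological degree `i` and quantum degree `j`. -/
abbrev Gen (i j : ℤ) : Type := {x : D.EnhancedState // x.homDeg = i ∧ x.qDeg = j}

instance (i j : ℤ) : Fintype (D.Gen i j) := Fintype.ofFinite _

variable (R : Type u) [CommRing R]

/-- `CKh^{i,j}(D)`, the free module on the generators of bidegree `(i, j)`. -/
abbrev CKh (i j : ℤ) : Type u := D.Gen i j →₀ R

/-- The Khovanov differential, as the map from `CKh^{i,j}(D)` to `CKh^{i',j}(D)` (which is of
interest for `i' = i + 1` only). -/
def diff (i i' j : ℤ) : D.CKh R i j →ₗ[R] D.CKh R i' j :=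
  Finsupp.linearCombination R fun x : D.Gen i j =>
    ∑ y : D.Gen i' j, Finsupp.single y (diffCoeff R x.1 y.1)

/-- The annular filtration: `F_k` is spanned by the generators of annular degree at most `k`. -/
def filt (i j k : ℤ) : Submodule R (D.CKh R i j) :=
  Finsupp.supported R R {x : D.Gen i j | x.1.annDeg ≤ k}

end AnnularDiagram

/-- The `k`-th graded piece `F_k / F_{k-1}` of a filtered module. -/
abbrev GrPiece {R : Type u} [CommRing R] {M : Type u} [AddCommGroup M] [Module R M]
    (F : ℤ → Submodule R M) (k : ℤ) : Type u :=
  F k ⧸ (F (k - 1)).submoduleOf (F k)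

open Classical in
/-- The map that a filtered map `f` induces on the `k`-th graded pieces (and `0` if `f` is not
filtered). -/
def grMap {R : Type u} [CommRing R] {M N : Type u} [AddCommGroup M] [Module R M]
    [AddCommGroup N] [Module R N] (F : ℤ → Submodule R M) (G : ℤ → Submodule R N)
    (f : M →ₗ[R] N) (k : ℤ) : GrPiece F k →ₗ[R] GrPiece G k :=
  if h : ∀ l, ∀ x ∈ F l, f x ∈ G l then
    Submodule.mapQ _ _ (f.restrict (h k)) (fun x hx => h (k - 1) x hx)
  else 0

/-- The homology `ker g / im f` at the middle term of `A → B → C`. -/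
abbrev HomologyAt {R : Type u} [CommRing R] {A B C : Type u} [AddCommGroup A] [Module R A]
    [AddCommGroup B] [Module R B] [AddCommGroup C] [Module R C]
    (f : A →ₗ[R] B) (g : B →ₗ[R] C) : Type u :=
  LinearMap.ker g ⧸ (LinearMap.range f).submoduleOf (LinearMap.ker g)

namespace AnnularDiagram

variable (D : AnnularDiagram) (R : Type u) [CommRing R]

/-- Khovanov homology `Kh^{i,j}`. -/
abbrev Kh (i j : ℤ) : Type u := HomologyAt (D.diff R (i - 1) i j) (D.diff R i (i + 1) j)

/-- The differential of the associated graded complex of the annular filtration. -/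
def grDiff (i i' j k : ℤ) : GrPiece (D.filt R i j) k →ₗ[R] GrPiece (D.filt R i' j) k :=
  grMap (D.filt R i j) (D.filt R i' j) (D.diff R i i' j) k

/-- Annular Khovanov homology `AKh^{i,j,k}`: the homology of the associated graded complex of the
Khovanov complex with respect to the annular filtration. -/
abbrev AKh (i j k : ℤ) : Type u :=
  HomologyAt (D.grDiff R (i - 1) i j k) (D.grDiff R i (i + 1) j k)

/-- The filtration that the annular filtration induces on Khovanov homology: `F_k Kh^{i,j}`
consists of the classes that have a representative in `F_k CKh^{i,j}`. -/
def khFilt (i j k : ℤ) : Submodule R (D.Kh R i j) :=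
  ((D.filt R i j k).submoduleOf (LinearMap.ker (D.diff R i (i + 1) j))).map
    (Submodule.mkQ _)

end AnnularDiagram

/-! ### Spectral sequences -/

/-- Spectral sequences of `R`-modules with pages `E₁, E₂, …`, tri-graded by a homological degree `i`,
a quantum degree `j` and a filtration degree `k`, in which the differential `d_r` has degree
`(1, 0, -r)`. -/
abbrev TrigradedSpectralSequence (R : Type u) [CommRing R] : Type _ :=
  SpectralSequence (ModuleCat.{u} R) (fun r : ℤ => ComplexShape.up' ((1, 0, -r) : ℤ × ℤ × ℤ)) 1

/-- The spectral sequence `E` converges to the bigraded module `H`, filtered by `F`: the filtration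
is bounded, and from some page on the differentials vanish and the page is isomorphic to the
associated graded module of `H`. -/
def TrigradedSpectralSequence.ConvergesTo {R : Type u} [CommRing R]
    (E : TrigradedSpectralSequence R) {H : ℤ → ℤ → Type u} [∀ i j, AddCommGroup (H i j)]
    [∀ i j, Module R (H i j)] (F : ∀ i j, ℤ → Submodule R (H i j)) : Prop :=
  (∀ i j, Monotone (F i j) ∧ (∃ a, F i j a = ⊥) ∧ (∃ b, F i j b = ⊤)) ∧
  ∃ (N : ℤ) (hN : 1 ≤ N), ∀ (r : ℤ) (hr : N ≤ r),
    (∀ p p', (E.page r (hN.trans hr)).d p p' = 0) ∧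
    ∀ i j k, Nonempty ((E.page r (hN.trans hr)).X (i, j, k) ≃ₗ[R] GrPiece (F i j) k)

end

/-! # The spectral sequence from annular Khovanov homology to Khovanov homology -/

noncomputable section

/-! ### The spectral sequence of a filtered complex -/

/-! A complex with a bounded filtration has a convergent spectral sequence. The substance is that
the Khovanov differential squares to zero and respects the filtration, for diagrams whose planarity
is encoded by Euler's formula.

Algebra: all bidegrees live in one module, so that degrees which agree only up to integer arithmetic
need no transport. The page `E_r` is `Z_r / B_r`, where `Z_r` consists of the `x` in `F_k` with `d
x` in `F_{k-r}`, and `B_r` is `d Z_{r-1}` from level `k+r-1` plus `Z_{r-1}` from level `k-1`. Its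
homology is `E_{r+1}` by `toHomology_surjective` and `toHomology_eq_zero_iff`. The first page is
computed in `nonempty_E_one_equiv`, the late ones in `Bounded.nonempty_E_equiv`.

Planarity: by a dimension count, every mod 2 cycle of the plane graph bounds a set of regions
(`range_regionBoundary`). Applied to the sum of all edges, this gives a checkerboard colouring. The
circles of a resolution then become cycles of a permutation of the black half-edges, and changing
one crossing multiplies it by a transposition; hence two circles merge or one splits
(`circleOf_eq_iff_not`). Applied to a single circle, it gives a function on regions whose value at
the puncture is the homology class, so that classes add mod 2 when circles merge
(`homologyClass_of_merge`).

Square zero: each edge map of the cube commutes with the operators `v₊ ↦ v₋`, `v₋ ↦ 0`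
(`crossingMap_lowerMap`). These operators generate everything from the all-`v₊` states, so it is
enough to compare the two ways around a face on such a state, which is combinatorics of circles
(`square_cases`). The signs make commuting faces anticommute.

Filtration: a sum of signs weighted by a function of circles changes only at the crossing
(`weightedSum_of_occurs`). Weight `1` yields the quantum degree, and the homology class yields the
annular degree, which never rises (`annDeg_of_occurs`). -/

/-- A surjection from a submodule whose kernel is cut out by `B` presents its target as a
quotient. -/
theorem Submodule.nonempty_quotientEquiv {R M Q : Type*} [CommRing R] [AddCommGroup M] [Module R M]
    [AddCommGroup Q] [Module R Q] {Z B : Submodule R M} (φ : Z →ₗ[R] Q)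
    (hφ : Function.Surjective φ) (hB : ∀ x : Z, φ x = 0 ↔ (x : M) ∈ B) :
    Nonempty ((Z ⧸ B.submoduleOf Z) ≃ₗ[R] Q) :=
  ⟨(Submodule.quotEquivOfEq _ _ (by ext x; exact (hB x).symm)).trans
    (φ.quotKerEquivOfSurjective hφ)⟩

/-- A differential on a module together with a family of submodules, which are indexed by two
degrees and increase with a filtration index, such that the differential raises the first degree
by one and respects the filtration. -/
structure TrigradedFiltration (R M : Type u) [CommRing R] [AddCommGroup M] [Module R M] where
  /-- the differential -/
  d : M →ₗ[R] M
  d_d : ∀ x, d (d x) = 0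
  /-- the `k`-th step of the filtration in bidegree `(i, j)` -/
  F : ℤ → ℤ → ℤ → Submodule R M
  mono : ∀ i j k k', k ≤ k' → F i j k ≤ F i j k'
  map_d : ∀ i j k x, x ∈ F i j k → d x ∈ F (i + 1) j k

namespace TrigradedFiltration

variable {R M : Type u} [CommRing R] [AddCommGroup M] [Module R M] (T : TrigradedFiltration R M)

/-- The approximate cycles: elements of `F_k` whose differential lies in `F_{k-r}`. -/
def cyc (r i j k : ℤ) : Submodule R M := T.F i j k ⊓ (T.F (i + 1) j (k - r)).comap T.d

/-- The approximate boundaries. -/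
def bd (r i j k : ℤ) : Submodule R M :=
  (T.cyc (r - 1) (i - 1) j (k + r - 1)).map T.d ⊔ T.cyc (r - 1) i j (k - 1)

variable {T}

theorem mem_cyc {r i j k : ℤ} {x : M} :
    x ∈ T.cyc r i j k ↔ x ∈ T.F i j k ∧ T.d x ∈ T.F (i + 1) j (k - r) := Iff.rfl

theorem mem_bd {r i j k : ℤ} {x : M} :
    x ∈ T.bd r i j k ↔ ∃ w ∈ T.cyc (r - 1) (i - 1) j (k + r - 1),
      ∃ v ∈ T.cyc (r - 1) i j (k - 1), T.d w + v = x := by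
  simp only [bd, Submodule.mem_sup, Submodule.mem_map]
  constructor
  · rintro ⟨_, ⟨w, hw, rfl⟩, v, hv, rfl⟩
    exact ⟨w, hw, v, hv, rfl⟩
  · rintro ⟨w, hw, v, hv, rfl⟩
    exact ⟨_, ⟨w, hw, rfl⟩, v, hv, rfl⟩

/-- The index conditions are auto-params, so that memberships move between degrees such as `i - 1 +
1` and `i` without casts. -/
theorem F_mono {i i' j j' k k' : ℤ} {x : M} (hx : x ∈ T.F i j k) (hi : i = i' := by lia)
    (hj : j = j' := by lia) (h : k ≤ k' := by lia) : x ∈ T.F i' j' k' := by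
  subst hi hj
  exact T.mono _ _ _ _ h hx

theorem d_mem_F {i i' j j' k k' : ℤ} {x : M} (hx : x ∈ T.F i j k) (hi : i + 1 = i' := by lia)
    (hj : j = j' := by lia) (h : k ≤ k' := by lia) : T.d x ∈ T.F i' j' k' :=
  F_mono (T.map_d _ _ _ _ hx) hi hj h

/-- The index `s` is arbitrary because `d² = 0` makes every boundary a genuine cycle. -/
theorem d_mem_cyc {r i i' j j' k k' : ℤ} {x : M} (hx : x ∈ T.cyc r i j k) (s : ℤ)
    (hi : i + 1 = i' := by lia) (hj : j = j' := by lia) (h : k - r = k' := by lia) :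
    T.d x ∈ T.cyc s i' j' k' := by
  subst h hi hj
  exact mem_cyc.2 ⟨hx.2, by simp [T.d_d]⟩

theorem d_mem_bd {r i i' j j' k k' : ℤ} {x : M} (hx : x ∈ T.cyc (r - 1) i j k)
    (hi : i + 1 = i' := by lia) (hj : j = j' := by lia) (h : k - r + 1 = k' := by lia) :
    T.d x ∈ T.bd r i' j' k' := by
  refine mem_bd.2 ⟨x, mem_cyc.2 ⟨F_mono hx.1, F_mono hx.2⟩, 0, zero_mem _, add_zero _⟩

theorem mem_bd_of_mem_cyc {r i j k : ℤ} {x : M} (hx : x ∈ T.cyc (r - 1) i j (k - 1)) :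
    x ∈ T.bd r i j k := mem_bd.2 ⟨0, zero_mem _, x, hx, by simp⟩

theorem d_eq_of_d_add_eq {w v x : M} (h : T.d w + v = x) : T.d v = T.d x := by
  rw [← h, map_add, T.d_d, zero_add]

variable (T)

/-- The terms of the spectral sequence. -/
abbrev E (r i j k : ℤ) : Type u := T.cyc r i j k ⧸ (T.bd r i j k).submoduleOf (T.cyc r i j k)

open Classical in
/-- The differentials of the spectral sequence. -/
def dE (r i j k i' j' k' : ℤ) : T.E r i j k →ₗ[R] T.E r i' j' k' :=
  -- The target degree is free and the map is zero unless it is the right one; this matches the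
  -- shape of a `HomologicalComplex`.
  if h : i + 1 = i' ∧ j = j' ∧ k - r = k' then
    Submodule.mapQ _ _ (T.d.restrict (p := T.cyc r i j k) (q := T.cyc r i' j' k')
      (fun _ hx => d_mem_cyc hx r)) (fun x hx => by
        obtain ⟨w, hw, v, hv, hx⟩ := mem_bd.1 hx
        change T.d x ∈ T.bd r _ _ _
        exact d_eq_of_d_add_eq hx ▸ d_mem_bd hv)
  else 0

variable {T}

theorem dE_mk {r i j k i' j' k' : ℤ} {x : M} (hx : x ∈ T.cyc r i j k)
    (hi : i + 1 = i' := by lia) (hj : j = j' := by lia) (h : k - r = k' := by lia) :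
    T.dE r i j k i' j' k' (Submodule.Quotient.mk ⟨x, hx⟩) =
      Submodule.Quotient.mk ⟨T.d x, d_mem_cyc hx r⟩ := by
  rw [dE, dif_pos ⟨hi, hj, h⟩]
  rfl

theorem E_mk_eq_zero {r i j k : ℤ} {x : M} {hx : x ∈ T.cyc r i j k} :
    (Submodule.Quotient.mk ⟨x, hx⟩ : T.E r i j k) = 0 ↔ x ∈ T.bd r i j k :=
  Submodule.Quotient.mk_eq_zero _

theorem E_exists_rep {r i j k : ℤ} (y : T.E r i j k) :
    ∃ (x : M) (hx : x ∈ T.cyc r i j k), Submodule.Quotient.mk ⟨x, hx⟩ = y := by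
  obtain ⟨⟨x, hx⟩, rfl⟩ := Submodule.Quotient.mk_surjective _ y
  exact ⟨x, hx, rfl⟩

theorem dE_dE {r i j k i' j' k' i'' j'' k'' : ℤ} (y : T.E r i j k) :
    T.dE r i' j' k' i'' j'' k'' (T.dE r i j k i' j' k' y) = 0 := by
  by_cases h : i + 1 = i' ∧ j = j' ∧ k - r = k'
  · by_cases h' : i' + 1 = i'' ∧ j' = j'' ∧ k' - r = k''
    · obtain ⟨x, hx, rfl⟩ := E_exists_rep y
      rw [dE_mk hx, dE_mk, E_mk_eq_zero, T.d_d]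
      exact zero_mem _
    · rw [dE, dif_neg h', LinearMap.zero_apply]
  · rw [dE, dE, dif_neg h, LinearMap.zero_apply, map_zero]

theorem cyc_succ_le {r i j k : ℤ} : T.cyc (r + 1) i j k ≤ T.cyc r i j k :=
  fun _ hx => mem_cyc.2 ⟨hx.1, F_mono hx.2⟩

variable (T)

/-- The pages of the spectral sequence. -/
def page (r : ℤ) : HomologicalComplex (ModuleCat.{u} R)
    (ComplexShape.up' ((1, 0, -r) : ℤ × ℤ × ℤ)) where
  X p := ModuleCat.of R (T.E r p.1 p.2.1 p.2.2)
  d p p' := ModuleCat.ofHom (T.dE r p.1 p.2.1 p.2.2 p'.1 p'.2.1 p'.2.2)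
  shape p p' h := by
    rw [dE, dif_neg]
    · rfl
    · rintro ⟨h₁, h₂, h₃⟩
      exact h (Prod.ext h₁ (Prod.ext (by simpa using h₂) (by simpa [sub_eq_add_neg] using h₃)))
  d_comp_d' p p' p'' _ _ := ModuleCat.hom_ext (LinearMap.ext fun y => dE_dE y)

/-- An element of the next page as a homology class. -/
def toHomology (r i j k : ℤ) : T.cyc (r + 1) i j k →ₗ[R]
    HomologyAt (T.dE r (i - 1) j (k + r) i j k) (T.dE r i j k (i + 1) j (k - r)) :=
  (Submodule.mkQ _).comp
    (((Submodule.mkQ _).comp (Submodule.inclusion cyc_succ_le)).codRestrict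
      (LinearMap.ker (T.dE r i j k (i + 1) j (k - r))) fun x => by
        refine (dE_mk (cyc_succ_le x.2)).trans (E_mk_eq_zero.2 ?_)
        -- Here `d x` lies one filtration step below `k - r`, hence in the second summand of `bd`.
        refine mem_bd_of_mem_cyc (mem_cyc.2 ⟨F_mono x.2.2, ?_⟩)
        rw [T.d_d]
        exact zero_mem _)

/-- If `d_r` kills the class of `z`, then `d z = d w + v` with `w` in `F_{k-1}` and `v` in
`F_{k-r-1}`. The correction `z - w` is an approximate cycle for `r + 1` and has the same class as
`z`. -/
theorem toHomology_surjective (r i j k : ℤ) : Function.Surjective (T.toHomology r i j k) := by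
  intro y
  obtain ⟨⟨y, hy⟩, rfl⟩ := Submodule.Quotient.mk_surjective _ y
  obtain ⟨z, hz, rfl⟩ := E_exists_rep y
  rw [LinearMap.mem_ker, dE_mk hz, E_mk_eq_zero, mem_bd] at hy
  obtain ⟨w, hw, v, hv, hwv⟩ := hy
  have hw1 : w ∈ T.F i j (k - 1) := F_mono hw.1
  have hdw : T.d w ∈ T.F (i + 1) j (k - r) := F_mono hw.2
  have hzw : z - w ∈ T.cyc (r + 1) i j k := by
    refine mem_cyc.2 ⟨sub_mem hz.1 (F_mono hw1), ?_⟩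
    rw [map_sub, ← hwv, add_sub_cancel_left]
    exact F_mono hv.1
  refine ⟨⟨z - w, hzw⟩, ?_⟩
  refine congrArg (Submodule.Quotient.mk) (Subtype.ext ?_)
  refine (Submodule.Quotient.eq _).2 ?_
  change z - w - z ∈ T.bd r _ _ _
  rw [sub_sub_cancel_left]
  exact neg_mem (mem_bd_of_mem_cyc (mem_cyc.2 ⟨hw1, F_mono hdw⟩))

/-- If `x - d y = d w + v` in `bd r`, then `x = d (y + w) + v` with `d v = d x` in `F_{k-r-1}`,
which is what `bd (r + 1)` asks for. Conversely, the `w` of such a decomposition represents a class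
that `d_r` sends to that of `x`. -/
theorem toHomology_eq_zero_iff (r i j k : ℤ) (x : T.cyc (r + 1) i j k) :
    T.toHomology r i j k x = 0 ↔ (x : M) ∈ T.bd (r + 1) i j k := by
  obtain ⟨x, hx⟩ := x
  have key : T.toHomology r i j k ⟨x, hx⟩ = 0 ↔ ∃ y : T.E r (i - 1) j (k + r),
      T.dE r (i - 1) j (k + r) i j k y = Submodule.Quotient.mk ⟨x, cyc_succ_le hx⟩ :=
    Submodule.Quotient.mk_eq_zero _
  rw [key]
  constructor
  · rintro ⟨y, hy⟩
    obtain ⟨y, hy', rfl⟩ := E_exists_rep y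
    rw [dE_mk hy', eq_comm, ← sub_eq_zero, ← Submodule.Quotient.mk_sub] at hy
    have hb : x - T.d y ∈ T.bd r i j k := E_mk_eq_zero.1 hy
    obtain ⟨w, hw, v, hv, hwv⟩ := mem_bd.1 hb
    refine mem_bd.2 ⟨y + w, mem_cyc.2 ⟨add_mem (F_mono hy'.1) (F_mono hw.1), ?_⟩, v,
      mem_cyc.2 ⟨F_mono hv.1, ?_⟩, ?_⟩
    · rw [map_add]
      exact add_mem (F_mono hy'.2) (F_mono hw.2)
    · rw [d_eq_of_d_add_eq hwv, map_sub, T.d_d, sub_zero]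
      exact F_mono hx.2
    · rw [map_add, add_assoc, hwv]
      abel
  · intro hb
    obtain ⟨w, hw, v, hv, hwv⟩ := mem_bd.1 hb
    have hw' : w ∈ T.cyc r (i - 1) j (k + r) := mem_cyc.2 ⟨F_mono hw.1, F_mono hw.2⟩
    refine ⟨Submodule.Quotient.mk ⟨w, hw'⟩, ?_⟩
    rw [dE_mk hw', eq_comm, ← sub_eq_zero, ← Submodule.Quotient.mk_sub]
    refine E_mk_eq_zero.2 ?_
    change x - T.d w ∈ _
    rw [← show T.d w + v = x from hwv, add_sub_cancel_left]
    exact mem_bd_of_mem_cyc (mem_cyc.2 ⟨hv.1, F_mono hv.2⟩)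

/-- Reconciles `HomologyAt` with the form of homology used for short complexes of modules, where
boundaries are the range of a map into the kernel. -/
theorem HomologyAt_eq_range {A B C : Type u} [AddCommGroup A] [Module R A]
    [AddCommGroup B] [Module R B] [AddCommGroup C] [Module R C]
    (f : A →ₗ[R] B) (g : B →ₗ[R] C) (h : ∀ x, f x ∈ LinearMap.ker g) :
    (LinearMap.range f).submoduleOf (LinearMap.ker g) = LinearMap.range (f.codRestrict _ h) := by
  ext x
  change (x : B) ∈ LinearMap.range f ↔ _
  simp [Subtype.ext_iff]

theorem nonempty_pageIso (r r' : ℤ) (p : ℤ × ℤ × ℤ) (h : r + 1 = r') :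
    Nonempty ((T.page r).homology p ≅ (T.page r').X p) := by
  subst h
  obtain ⟨i, j, k⟩ := p
  obtain ⟨e⟩ := Submodule.nonempty_quotientEquiv _ (T.toHomology_surjective r i j k)
    (T.toHomology_eq_zero_iff r i j k)
  let S := (T.page r).sc' (i - 1, j, k + r) (i, j, k) (i + 1, j, k - r)
  have e' : S.homology ≅
      ModuleCat.of R (LinearMap.ker S.g.hom ⧸ LinearMap.range S.moduleCatToCycles) :=
    S.moduleCatHomologyIso
  have hi : (ComplexShape.up' ((1, 0, -r) : ℤ × ℤ × ℤ)).prev (i, j, k) = (i - 1, j, k + r) :=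
    ComplexShape.prev_eq' _ (by simp)
  have hk : (ComplexShape.up' ((1, 0, -r) : ℤ × ℤ × ℤ)).next (i, j, k) = (i + 1, j, k - r) :=
    ComplexShape.next_eq' _ (by simp [sub_eq_add_neg])
  have e₁ : (LinearMap.ker S.g.hom ⧸ LinearMap.range S.moduleCatToCycles) ≃ₗ[R]
      HomologyAt (T.dE r (i - 1) j (k + r) i j k) (T.dE r i j k (i + 1) j (k - r)) :=
    Submodule.quotEquivOfEq _ _ (HomologyAt_eq_range S.f.hom S.g.hom fun x => dE_dE x).symm
  exact ⟨(T.page r).homologyIsoSc' _ _ _ hi hk ≪≫ e' ≪≫ (e₁.trans e.symm).toModuleIso⟩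

/-- The spectral sequence of a filtered complex. -/
def spectralSequence : TrigradedSpectralSequence R where
  page r _ := T.page r
  iso r r' p h _ := (T.nonempty_pageIso r r' p h).some

end TrigradedFiltration

/-! ### Comparison of the first and the late pages with homology. -/

/-- Two surjections with the same kernel have isomorphic targets. -/
theorem LinearMap.nonempty_equiv_of_surjective {R Z P Q : Type*} [CommRing R]
    [AddCommGroup Z] [Module R Z] [AddCommGroup P] [Module R P] [AddCommGroup Q] [Module R Q]
    (α : Z →ₗ[R] P) (β : Z →ₗ[R] Q) (hα : Function.Surjective α) (hβ : Function.Surjective β)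
    (h : ∀ x, α x = 0 ↔ β x = 0) : Nonempty (P ≃ₗ[R] Q) :=
  ⟨((α.quotKerEquivOfSurjective hα).symm.trans
    (Submodule.quotEquivOfEq _ _ (by ext x; exact h x))).trans (β.quotKerEquivOfSurjective hβ)⟩

/-- The filtration on homology that is induced by a filtration on the middle term. -/
def homologyFilt {R : Type u} [CommRing R] {A B C : Type u} [AddCommGroup A] [Module R A]
    [AddCommGroup B] [Module R B] [AddCommGroup C] [Module R C]
    (f : A →ₗ[R] B) (g : B →ₗ[R] C) (F : ℤ → Submodule R B) (k : ℤ) :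
    Submodule R (HomologyAt f g) :=
  ((F k).submoduleOf (LinearMap.ker g)).map (Submodule.mkQ _)

namespace TrigradedFiltration

variable {R M : Type u} [CommRing R] [AddCommGroup M] [Module R M] {T : TrigradedFiltration R M}
  {A B C : Type u} [AddCommGroup A] [Module R A] [AddCommGroup B] [Module R B] [AddCommGroup C]
  [Module R C] {f : A →ₗ[R] B} {g : B →ₗ[R] C} {a : A →ₗ[R] M} {b : B →ₗ[R] M} {c : C →ₗ[R] M}
  {FA : ℤ → Submodule R A} {FB : ℤ → Submodule R B} {FC : ℤ → Submodule R C} {i j : ℤ}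

/-- The projection from the approximate cycles to the term of the spectral sequence, for approximate
cycles that are given in a copy `B` of the module in bidegree `(i, j)`. -/
def comapToE (T : TrigradedFiltration R M) (b : B →ₗ[R] M) (r i j k : ℤ) :
    (T.cyc r i j k).comap b →ₗ[R] T.E r i j k :=
  (Submodule.mkQ _).comp (b.restrict (p := (T.cyc r i j k).comap b) fun _ hx => hx)

theorem comapToE_surjective (hb : ∀ k, T.F i j k ≤ LinearMap.range b) (r k : ℤ) :
    Function.Surjective (T.comapToE b r i j k) := by
  intro y
  obtain ⟨x, hx, rfl⟩ := E_exists_rep y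
  obtain ⟨x, rfl⟩ := hb k hx.1
  exact ⟨⟨x, hx⟩, rfl⟩

theorem comapToE_eq_zero {r k : ℤ} (x : (T.cyc r i j k).comap b) :
    T.comapToE b r i j k x = 0 ↔ b x ∈ T.bd r i j k :=
  Submodule.Quotient.mk_eq_zero _

theorem grMap_mk {F : ℤ → Submodule R A} {G : ℤ → Submodule R B} {f : A →ₗ[R] B}
    (h : ∀ l, ∀ x ∈ F l, f x ∈ G l) (k : ℤ) (x : F k) :
    grMap F G f k (Submodule.Quotient.mk x) = Submodule.Quotient.mk ⟨f x, h k x x.2⟩ := by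
  rw [grMap, dif_pos h]
  rfl

theorem grPiece_mk_eq_zero {F : ℤ → Submodule R B} {k : ℤ} (x : F k) :
    (Submodule.Quotient.mk x : GrPiece F k) = 0 ↔ (x : B) ∈ F (k - 1) :=
  Submodule.Quotient.mk_eq_zero _

/-- The first page is the homology of the associated graded complex. -/
theorem nonempty_E_one_equiv (hf : ∀ x, T.d (a x) = b (f x)) (hg : ∀ x, T.d (b x) = c (g x))
    (hA : ∀ k x, a x ∈ T.F (i - 1) j k ↔ x ∈ FA k) (ha : ∀ k, T.F (i - 1) j k ≤ LinearMap.range a)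
    (hB : ∀ k x, b x ∈ T.F i j k ↔ x ∈ FB k) (hb : ∀ k, T.F i j k ≤ LinearMap.range b)
    (hC : ∀ k x, c x ∈ T.F (i + 1) j k ↔ x ∈ FC k) (k : ℤ) :
    Nonempty (T.E 1 i j k ≃ₗ[R] HomologyAt (grMap FA FB f k) (grMap FB FC g k)) := by
  have hfF : ∀ l, ∀ x ∈ FA l, f x ∈ FB l := fun l x hx => by
    rw [← hB, ← hf]
    exact d_mem_F ((hA l x).2 hx)
  have hgF : ∀ l, ∀ x ∈ FB l, g x ∈ FC l := fun l x hx => by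
    rw [← hC, ← hg]
    exact d_mem_F ((hB l x).2 hx)
  let β₀ : (T.cyc 1 i j k).comap b →ₗ[R] LinearMap.ker (grMap FB FC g k) :=
    ((Submodule.mkQ _).comp
      (Submodule.inclusion (p := (T.cyc 1 i j k).comap b) (p' := FB k)
        fun x hx => (hB k x).1 hx.1)).codRestrict (LinearMap.ker (grMap FB FC g k)) fun x =>
          (grMap_mk hgF k _).trans ((grPiece_mk_eq_zero _).2
            ((hC _ _).1 (show c (g x) ∈ _ by rw [← hg]; exact x.2.2)))
  refine LinearMap.nonempty_equiv_of_surjective (T.comapToE b 1 i j k) ((Submodule.mkQ _).comp β₀)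
    (comapToE_surjective hb 1 k) ?_ ?_
  · intro y
    obtain ⟨⟨y, hy⟩, rfl⟩ := Submodule.Quotient.mk_surjective _ y
    obtain ⟨⟨x, hx⟩, rfl⟩ := Submodule.Quotient.mk_surjective _ y
    rw [LinearMap.mem_ker, grMap_mk hgF, grPiece_mk_eq_zero] at hy
    refine ⟨⟨x, mem_cyc.2 ⟨(hB k x).2 hx, ?_⟩⟩, rfl⟩
    rw [hg]
    exact (hC _ _).2 hy
  · rintro ⟨x, hx⟩
    have key : (Submodule.mkQ _).comp β₀ ⟨x, hx⟩ = (0 : HomologyAt (grMap FA FB f k)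
        (grMap FB FC g k)) ↔ ∃ y : GrPiece FA k, grMap FA FB f k y =
          Submodule.Quotient.mk ⟨x, (hB k x).1 hx.1⟩ :=
      Submodule.Quotient.mk_eq_zero _
    -- For `r = 1` the approximate cycles of index `r - 1 = 0` are all of `F`, because `d` is
    -- filtered; so `bd` is `d F_k + F_{k-1}`.
    rw [key, comapToE_eq_zero]
    constructor
    · intro h
      obtain ⟨w, hw, v, hv, h⟩ := mem_bd.1 h
      obtain ⟨w, rfl⟩ := ha _ hw.1
      refine ⟨Submodule.Quotient.mk ⟨w, (hA _ _).1 (F_mono hw.1)⟩, ?_⟩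
      rw [grMap_mk hfF, eq_comm, ← sub_eq_zero, ← Submodule.Quotient.mk_sub, grPiece_mk_eq_zero]
      change x - f w ∈ _
      rw [← hB, map_sub, ← hf, ← show _ = b x from h, add_sub_cancel_left]
      exact hv.1
    · rintro ⟨y, hy⟩
      obtain ⟨⟨y, hyF⟩, rfl⟩ := Submodule.Quotient.mk_surjective _ y
      rw [grMap_mk hfF, eq_comm, ← sub_eq_zero, ← Submodule.Quotient.mk_sub,
        grPiece_mk_eq_zero] at hy
      have hy' : b (x - f y) ∈ T.F i j (k - 1) := (hB _ _).2 hy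
      have hyA := (hA k y).2 hyF
      refine mem_bd.2 ⟨a y, mem_cyc.2 ⟨F_mono hyA, d_mem_F hyA⟩, b (x - f y),
        mem_cyc.2 ⟨hy', d_mem_F hy'⟩, ?_⟩
      rw [hf, ← map_add, add_sub_cancel]

theorem homologyFilt_mk {f : A →ₗ[R] B} {g : B →ₗ[R] C} {k : ℤ} {x : B} (hx : g x = 0) :
    (Submodule.Quotient.mk ⟨x, hx⟩ : HomologyAt f g) ∈ homologyFilt f g FB k ↔
      ∃ z ∈ FB k, g z = 0 ∧ ∃ y, f y = x - z := by
  rw [homologyFilt, Submodule.mem_map]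
  constructor
  · rintro ⟨⟨z, hz⟩, hzF, h⟩
    obtain ⟨y, hy⟩ : x - z ∈ LinearMap.range f := (Submodule.Quotient.eq
      ((LinearMap.range f).submoduleOf (LinearMap.ker g)) (x := ⟨x, hx⟩) (y := ⟨z, hz⟩)).1 h.symm
    exact ⟨z, hzF, hz, y, hy⟩
  · rintro ⟨z, hzF, hz, y, hy⟩
    exact ⟨⟨z, hz⟩, hzF, ((Submodule.Quotient.eq
      ((LinearMap.range f).submoduleOf (LinearMap.ker g)) (x := ⟨x, hx⟩) (y := ⟨z, hz⟩)).2
        ⟨y, hy⟩).symm⟩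

variable (T) in
/-- The filtration is constant up to `l` (where it vanishes) and from `u` on. -/
def Bounded (l u : ℤ) : Prop :=
  (∀ i j k, k ≤ l → T.F i j k = ⊥) ∧ ∀ i j k, u ≤ k → T.F i j k = T.F i j u

theorem Bounded.mem_F {l u : ℤ} (h : T.Bounded l u) {k k' : ℤ} {x : M} (hx : x ∈ T.F i j k)
    (hk : u ≤ k') : x ∈ T.F i j k' := by
  rcases le_total k u with h' | h'
  · exact F_mono hx
  · rw [h.2 _ _ _ h'] at hx
    rwa [h.2 _ _ _ hk]

/-- Above `u` the filtration is stationary, so an element of `F_k` already lies in `F_{k-1}`. -/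
theorem Bounded.cyc_le_bd {l u : ℤ} (h : T.Bounded l u) {r k : ℤ} (hk : u < k) :
    T.cyc r i j k ≤ T.bd r i j k := fun _ hx =>
  mem_bd_of_mem_cyc (mem_cyc.2 ⟨h.mem_F hx.1 (by lia), F_mono hx.2⟩)

/-- Either `k > u` and the source vanishes, or `k - r ≤ l` and `d y`, being in `F_{k-r}`, is zero.
-/
theorem Bounded.dE_eq_zero {l u : ℤ} (h : T.Bounded l u) {r : ℤ} (hr : u - l ≤ r)
    (i j k i' j' k' : ℤ) : T.dE r i j k i' j' k' = 0 := by
  by_cases hp : i + 1 = i' ∧ j = j' ∧ k - r = k'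
  · ext y
    obtain ⟨y, hy⟩ := y
    change T.dE r i j k i' j' k' (Submodule.Quotient.mk ⟨y, hy⟩) = 0
    by_cases hk : u < k
    · rw [E_mk_eq_zero.2 (h.cyc_le_bd hk hy), map_zero]
    · have := hy.2
      rw [h.1 _ _ _ (by lia)] at this
      rw [dE_mk hy, E_mk_eq_zero, show T.d y = 0 from this]
      exact zero_mem _
  · rw [dE, dif_neg hp]

/-- The late pages are the associated graded modules of the homology. -/
theorem Bounded.nonempty_E_equiv {l u : ℤ} (h : T.Bounded l u) {r : ℤ} (hr : u - l < r)
    (hf : ∀ x, T.d (a x) = b (f x)) (hg : ∀ x, T.d (b x) = c (g x))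
    (hb_inj : Function.Injective b) (hc_inj : Function.Injective c)
    (hA : ∀ x, ∃ k, a x ∈ T.F (i - 1) j k) (ha : ∀ k, T.F (i - 1) j k ≤ LinearMap.range a)
    (hB : ∀ k x, b x ∈ T.F i j k ↔ x ∈ FB k) (hb : ∀ k, T.F i j k ≤ LinearMap.range b) (k : ℤ) :
    Nonempty (T.E r i j k ≃ₗ[R] GrPiece (homologyFilt f g FB) k) := by
  by_cases hk : u < k
  · have h₁ : Subsingleton (T.E r i j k) := by
      refine subsingleton_of_forall_eq 0 fun y => ?_
      obtain ⟨y, hy, rfl⟩ := E_exists_rep y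
      exact E_mk_eq_zero.2 (h.cyc_le_bd hk hy)
    have h₂ : Subsingleton (GrPiece (homologyFilt f g FB) k) := by
      refine subsingleton_of_forall_eq 0 fun y => ?_
      obtain ⟨⟨y, hy⟩, rfl⟩ := Submodule.Quotient.mk_surjective _ y
      obtain ⟨⟨y, hy'⟩, rfl⟩ := Submodule.Quotient.mk_surjective _ y
      refine (grPiece_mk_eq_zero _).2 ?_
      obtain ⟨z, hz, h0⟩ := (homologyFilt_mk hy').1 hy
      exact (homologyFilt_mk hy').2 ⟨z, (hB _ _).1 (h.mem_F ((hB _ _).2 hz) (by lia)), h0⟩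
    exact ⟨0, 0, fun _ => Subsingleton.elim _ _, fun _ => Subsingleton.elim _ _⟩
  -- From `k ≤ u` and `u - l < r` it follows that `k - r < l`, so approximate cycles are honest
  -- cycles.
  have hcyc : ∀ x, b x ∈ T.cyc r i j k → g x = 0 := fun x hx => by
    have := hx.2
    rw [h.1 _ _ _ (by lia)] at this
    exact hc_inj (by rw [map_zero, ← hg]; exact this)
  let β₀ : (T.cyc r i j k).comap b →ₗ[R] homologyFilt f g FB k :=
    ((Submodule.mkQ _).comp (Submodule.inclusion (p := (T.cyc r i j k).comap b)
      (p' := LinearMap.ker g) hcyc)).codRestrict _ fun x =>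
        (homologyFilt_mk (hcyc x x.2)).2
          ⟨x, (hB _ _).1 x.2.1, hcyc x x.2, 0, by rw [sub_self, map_zero]⟩
  refine LinearMap.nonempty_equiv_of_surjective (T.comapToE b r i j k) ((Submodule.mkQ _).comp β₀)
    (comapToE_surjective hb r k) ?_ ?_
  · intro y
    obtain ⟨⟨y, hy⟩, rfl⟩ := Submodule.Quotient.mk_surjective _ y
    obtain ⟨⟨z, hz⟩, hzF, rfl⟩ := hy
    refine ⟨⟨z, mem_cyc.2 ⟨(hB _ _).2 hzF, ?_⟩⟩, rfl⟩
    rw [hg, show g z = 0 from hz, map_zero]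
    exact zero_mem _
  · rintro ⟨x, hx⟩
    have key : (Submodule.mkQ _).comp β₀ ⟨x, hx⟩ = (0 : GrPiece (homologyFilt f g FB) k) ↔
        (Submodule.Quotient.mk ⟨x, hcyc x hx⟩ : HomologyAt f g) ∈ homologyFilt f g FB (k - 1) :=
      Submodule.Quotient.mk_eq_zero _
    rw [key, comapToE_eq_zero, homologyFilt_mk (hcyc x hx)]
    constructor
    · intro h'
      obtain ⟨w, hw, v, hv, h'⟩ := mem_bd.1 h'
      obtain ⟨w, rfl⟩ := ha _ hw.1
      obtain ⟨v, rfl⟩ := hb _ hv.1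
      rw [hf, ← map_add] at h'
      have hx' : f w + v = x := hb_inj h'
      refine ⟨v, (hB _ _).1 hv.1, ?_, w, by rw [← hx', add_sub_cancel_right]⟩
      have := hv.2
      rw [h.1 _ _ _ (by lia)] at this
      exact hc_inj (by rw [map_zero, ← hg]; exact this)
    · rintro ⟨z, hzF, hz, w, hw⟩
      have hzF := (hB _ _).2 hzF
      have hdz : T.d (b z) = 0 := by rw [hg, hz, map_zero]
      -- If `k ≤ l`, the element is zero. Otherwise `k + r - 1 ≥ u`, so the chain `a w` lies in the
      -- filtration step required by `bd`, wherever it started.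
      by_cases hkl : k ≤ l
      · have := hx.1
        rw [h.1 _ _ _ hkl] at this
        rw [show b x = 0 from this]
        exact zero_mem _
      refine mem_bd.2 ⟨a w, mem_cyc.2 ⟨?_, ?_⟩, b z, mem_cyc.2 ⟨hzF, ?_⟩, ?_⟩
      · obtain ⟨k', hk'⟩ := hA w
        exact h.mem_F hk' (by lia)
      · rw [hf, hw, map_sub]
        exact sub_mem (F_mono hx.1) (F_mono hzF)
      · rw [hdz]
        exact zero_mem _
      · rw [hf, hw, ← map_add, sub_add_cancel]

end TrigradedFiltration

/-! ### Consequences of planarity -/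

namespace AnnularDiagram

variable {D : AnnularDiagram}

/-- The vertex of a half-edge. -/
def vert {n m : ℕ} : Dart n m → Fin n ⊕ Fin m := Sum.map Prod.fst Prod.fst

theorem vert_rot {n m : ℕ} (d : Dart n m) : vert d.rot = vert d := by
  rcases d with ⟨c, i⟩ | ⟨p, b⟩ <;> rfl

theorem rot_bijective {n m : ℕ} : Function.Bijective (Dart.rot : Dart n m → Dart n m) := by
  refine Finite.injective_iff_bijective.1 ?_
  rintro (⟨c, i⟩ | ⟨p, b⟩) (⟨c', i'⟩ | ⟨p', b'⟩) h <;> simp_all [Dart.rot]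

theorem smooth_smooth (S : D.Resolution) (d : Dart D.n D.m) : smooth S (smooth S d) = d := by
  rcases d with ⟨c, i⟩ | ⟨p, b⟩
  · by_cases h : S c <;> simp [smooth, h]
  · simp [smooth]

theorem vert_smooth (S : D.Resolution) (d : Dart D.n D.m) : vert (smooth S d) = vert d := by
  rcases d with ⟨c, i⟩ | ⟨p, b⟩ <;> rfl

theorem smooth_ne (S : D.Resolution) (d : Dart D.n D.m) : smooth S d ≠ d := by
  rcases d with ⟨c, i⟩ | ⟨p, b⟩
  · have h₁ : ∀ i : ZMod 4, 3 - i ≠ i := by decide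
    have h₂ : ∀ i : ZMod 4, 1 - i ≠ i := by decide
    by_cases h : S c <;> simp [smooth, h, h₁, h₂]
  · simp [smooth]

variable (D)

/-- The edges, represented by their outgoing half-edges. -/
abbrev Edge : Type := {d : Dart D.n D.m // D.out d = true}

variable {D} in
-- The orientation of the link singles out one of the two half-edges of each edge.
theorem sum_dart {K : Type*} [AddCommMonoid K] (g : Dart D.n D.m → K) :
    ∑ d, g d = ∑ e : D.Edge, (g e + g (D.edge e)) := by
  rw [Finset.sum_add_distrib, ← Fintype.sum_subtype_add_sum_subtype (fun d => D.out d = true) g]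
  congr 1
  have h₁ : ∀ e : D.Edge, ¬ D.out (D.edge e) = true := fun e => by simp [D.out_edge, e.2]
  have h₂ : ∀ e : {d // ¬ D.out d = true}, D.out (D.edge e) = true := fun e => by
    simpa [D.out_edge] using e.2
  exact (Fintype.sum_equiv (⟨fun e => ⟨D.edge e, h₁ e⟩, fun e => ⟨D.edge e, h₂ e⟩,
    fun e => Subtype.ext (D.edge_edge e), fun e => Subtype.ext (D.edge_edge e)⟩ :
      D.Edge ≃ {d // ¬ D.out d = true}) _ _ fun e => rfl).symm

/-- Handshake lemma: there are `4n + 2m` half-edges, two on each edge. -/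
theorem card_edge : Fintype.card D.Edge = 2 * D.n + D.m := by
  have h := sum_dart (D := D) fun _ => 1
  have h4 : Fintype.card (Dart D.n D.m) = D.n * 4 + D.m * 2 := by simp [ZMod.card]
  simp only [Finset.sum_const, Finset.card_univ, smul_eq_mul, mul_one] at h
  lia

/-- The incidence matrix mod `2`. -/
def incidence : Matrix D.Edge (Fin D.n ⊕ Fin D.m) (ZMod 2) :=
  fun e v => (if vert e.1 = v then 1 else 0) + if vert (D.edge e) = v then 1 else 0

theorem incidence_mulVec (g : Fin D.n ⊕ Fin D.m → ZMod 2) (e : D.Edge) :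
    D.incidence.mulVec g e = g (vert e.1) + g (vert (D.edge e)) := by
  simp [incidence, Matrix.mulVec, dotProduct, add_mul, Finset.sum_add_distrib]

theorem incidence_transpose_mulVec (f : Dart D.n D.m → ZMod 2) (hf : ∀ d, f (D.edge d) = f d)
    (v : Fin D.n ⊕ Fin D.m) :
    D.incidence.transpose.mulVec (fun e => f e) v = ∑ d, if vert d = v then f d else 0 := by
  rw [sum_dart]
  simp [incidence, Matrix.mulVec, dotProduct, add_mul, hf]

/-- The connected components of the diagram. -/
abbrev Component : Type := Quot fun d d' : Dart D.n D.m => d' = D.edge d ∨ d' = d.rot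

/-- The connected component of a vertex. -/
def componentOf : Fin D.n ⊕ Fin D.m → D.Component
  | Sum.inl c => Quot.mk _ (Sum.inl (c, 0))
  | Sum.inr p => Quot.mk _ (Sum.inr (p, false))

theorem componentOf_vert (d : Dart D.n D.m) : D.componentOf (vert d) = Quot.mk _ d := by
  have h : ∀ d : Dart D.n D.m, (Quot.mk _ d : D.Component) = Quot.mk _ d.rot :=
    fun d => Quot.sound (Or.inr rfl)
  rcases d with ⟨c, i⟩ | ⟨p, b⟩
  · obtain ⟨k, rfl⟩ : ∃ k : ℕ, (k : ZMod 4) = i := ⟨i.val, by simp⟩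
    induction k with
    | zero => simp [vert, componentOf]
    | succ k ih =>
      refine Eq.trans (b := D.componentOf (vert (Sum.inl (c, (k : ZMod 4))))) rfl (ih.trans ?_)
      rw [h]
      rw [Nat.cast_succ]
      rfl
  · cases b
    · rfl
    · exact h _

/-- A function mod `2` on the vertices is in the kernel when it agrees at the two ends of every
edge, and then it descends to the components. -/
theorem ker_incidence : LinearMap.ker D.incidence.mulVecLin =
    LinearMap.range (LinearMap.funLeft (ZMod 2) (ZMod 2) D.componentOf) := by
  ext g
  rw [LinearMap.mem_ker, LinearMap.mem_range]
  constructor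
  · intro hg
    have hg' : ∀ e : D.Edge, g (vert e.1) = g (vert (D.edge e)) := fun e => by
      have := congrFun hg e
      rw [Matrix.mulVecLin_apply, incidence_mulVec] at this
      exact CharTwo.add_eq_zero.1 this
    refine ⟨Quot.lift (fun d => g (vert d)) ?_, ?_⟩
    · rintro d _ (rfl | rfl)
      · by_cases h : D.out d = true
        · exact hg' ⟨d, h⟩
        · have := hg' ⟨D.edge d, by simp [D.out_edge, h]⟩
          rw [D.edge_edge] at this
          exact this.symm
      · simp only [vert_rot]
    · ext v
      rcases v with c | p <;> rfl
  · rintro ⟨h, rfl⟩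
    ext e
    rw [Matrix.mulVecLin_apply, incidence_mulVec, LinearMap.funLeft_apply, LinearMap.funLeft_apply,
      componentOf_vert, componentOf_vert, ← show Quot.mk _ e.1 = Quot.mk _ (D.edge e) from
      Quot.sound (Or.inl rfl)]
    exact CharTwo.add_self_eq_zero _

instance : Finite D.Component := Finite.of_surjective _ Quot.mk_surjective

theorem rank_incidence : D.incidence.rank + Nat.card D.Component = D.n + D.m := by
  have h := LinearMap.finrank_range_add_finrank_ker D.incidence.mulVecLin
  rw [ker_incidence, LinearMap.finrank_range_of_inj (f := LinearMap.funLeft _ _ _)] at h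
  · have := Fintype.ofFinite D.Component
    rw [Module.finrank_fintype_fun_eq_card, Module.finrank_fintype_fun_eq_card,
      Fintype.card_sum, Fintype.card_fin, Fintype.card_fin] at h
    rw [Matrix.rank, Nat.card_eq_fintype_card, h]
  · refine LinearMap.funLeft_injective_of_surjective _ _ _ fun q => ?_
    obtain ⟨d, rfl⟩ := Quot.mk_surjective q
    exact ⟨_, D.componentOf_vert d⟩

/-- The boundary, mod `2`, of a set of regions. -/
def regionBoundary : (Fin D.numRegions → ZMod 2) →ₗ[ZMod 2] (D.Edge → ZMod 2) where
  toFun u e := u (D.region e) + u (D.region (D.edge e))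
  map_add' u v := by ext e; simp; ring
  map_smul' a u := by ext e; simp; ring

theorem eq_of_region_boundary_eq_zero {u : Fin D.numRegions → ZMod 2}
    (hu : ∀ d, u (D.region d) + u (D.region (D.edge d)) = 0) (r r' : Fin D.numRegions) :
    u r = u r' := by
  induction D.region_connected r r' with
  | rel a b h =>
    obtain ⟨d, rfl, rfl⟩ := h
    exact CharTwo.add_eq_zero.1 (hu d)
  | refl => rfl
  | symm _ _ _ ih => exact ih.symm
  | trans _ _ _ _ _ ih ih' => exact ih.trans ih'

theorem ker_regionBoundary : LinearMap.ker D.regionBoundary = Submodule.span (ZMod 2) {1} := by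
  ext u
  rw [LinearMap.mem_ker, Submodule.mem_span_singleton]
  constructor
  · intro hu
    have h : ∀ d, u (D.region d) + u (D.region (D.edge d)) = 0 := fun d => by
      by_cases h : D.out d = true
      · exact congrFun hu ⟨d, h⟩
      · have := congrFun hu ⟨D.edge d, by simp [D.out_edge, h]⟩
        change u (D.region (D.edge d)) + u (D.region (D.edge (D.edge d))) = 0 at this
        rwa [D.edge_edge, add_comm] at this
    refine ⟨u D.puncture, ?_⟩
    ext r
    simp [D.eq_of_region_boundary_eq_zero h r D.puncture]
  · rintro ⟨a, rfl⟩
    ext e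
    exact CharTwo.add_self_eq_zero _

theorem finrank_range_regionBoundary :
    Module.finrank (ZMod 2) (LinearMap.range D.regionBoundary) + 1 = D.numRegions := by
  have h := LinearMap.finrank_range_add_finrank_ker D.regionBoundary
  rw [ker_regionBoundary, finrank_span_singleton] at h
  · simpa using h
  · exact fun h => one_ne_zero (congrFun h D.puncture)

/-- Boundaries are cycles because, around a vertex, the region between `d` and `d.rot` is counted
once from each side. Both spaces have the same dimension: by Euler's formula, `F - 1 = E - (V - C)`,
where `V - C` is the rank of the incidence matrix. This is the vanishing of the first homology of
the plane mod `2`. -/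
theorem range_regionBoundary :
    LinearMap.range D.regionBoundary = LinearMap.ker D.incidence.transpose.mulVecLin := by
  refine Submodule.eq_of_le_of_finrank_eq ?_ ?_
  · rintro _ ⟨u, rfl⟩
    rw [LinearMap.mem_ker]
    ext v
    have := D.incidence_transpose_mulVec (fun d => u (D.region d) + u (D.region (D.edge d)))
      (fun d => by rw [D.edge_edge, add_comm]) v
    rw [Matrix.mulVecLin_apply]
    refine this.trans ?_
    have key : ∑ d, (if vert d = v then u (D.region (D.edge d)) else 0) =
        ∑ d, if vert d = v then u (D.region d) else 0 := by
      rw [← rot_bijective.sum_comp]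
      simp only [vert_rot, D.region_edge_rot]
    calc _ = ∑ d, (if vert d = v then u (D.region d) else 0) +
          ∑ d, (if vert d = v then u (D.region (D.edge d)) else 0) := by
            rw [← Finset.sum_add_distrib]
            exact Finset.sum_congr rfl fun d _ => by split_ifs <;> simp
      _ = 0 := by rw [key, CharTwo.add_self_eq_zero]
  · have h := LinearMap.finrank_range_add_finrank_ker D.incidence.transpose.mulVecLin
    have h₁ : Module.finrank (ZMod 2) (LinearMap.range D.incidence.transpose.mulVecLin) =
      D.incidence.rank := D.incidence.rank_transpose
    have h₂ := D.finrank_range_regionBoundary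
    have h₃ := D.rank_incidence
    have h₄ : D.n + D.m + D.numRegions = (2 * D.n + D.m) + 1 + Nat.card D.Component := D.euler
    rw [h₁, Module.finrank_fintype_fun_eq_card, card_edge] at h
    lia

variable {D}

/-- A function mod `2` on the edges which is invariant under joining the half-edges according to
some resolution is the boundary of a set of regions. -/
theorem exists_region_function (S : D.Resolution) (f : Dart D.n D.m → ZMod 2)
    (hf : ∀ d, f (D.edge d) = f d) (hS : ∀ d, f (smooth S d) = f d) :
    ∃ u : Fin D.numRegions → ZMod 2, ∀ d, f d = u (D.region d) + u (D.region (D.edge d)) := by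
  have h : (fun e : D.Edge => f e) ∈ LinearMap.range D.regionBoundary := by
    rw [range_regionBoundary, LinearMap.mem_ker]
    ext v
    rw [Matrix.mulVecLin_apply, incidence_transpose_mulVec _ _ hf]
    -- Smoothing pairs the half-edges at each vertex without fixed points, and `f` is equal on each
    -- pair, so the sum vanishes mod `2`.
    refine Finset.sum_involution (fun d _ => smooth S d) ?_ ?_ ?_ ?_
    · intro d _
      rw [vert_smooth, hS]
      exact CharTwo.add_self_eq_zero _
    · intro d _ _
      exact smooth_ne S d
    · simp
    · intro d _
      exact smooth_smooth S d
  obtain ⟨u, hu⟩ := h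
  refine ⟨u, fun d => ?_⟩
  by_cases h : D.out d = true
  · exact (congrFun hu ⟨d, h⟩).symm
  · have := congrFun hu ⟨D.edge d, by simp [D.out_edge, h]⟩
    change u (D.region (D.edge d)) + u (D.region (D.edge (D.edge d))) = f (D.edge d) at this
    rwa [D.edge_edge, add_comm, hf, eq_comm] at this

variable (D) in
/-- Every plane diagram has a checkerboard colouring. -/
theorem exists_checkerboard : ∃ χ : Dart D.n D.m → ZMod 2,
    (∀ d, χ (D.edge d) = χ d + 1) ∧ ∀ d, χ d.rot = χ d + 1 := by
  -- The constant function `1` is invariant under any resolution; the set of regions that it bounds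
  -- is one colour class.
  obtain ⟨u, hu⟩ := exists_region_function (D := D) (fun _ => false) (fun _ => 1) (fun _ => rfl)
    fun _ => rfl
  have h : ∀ d, u (D.region (D.edge d)) = u (D.region d) + 1 := fun d => by
    rw [hu d, ← add_assoc, CharTwo.add_self_eq_zero, zero_add]
  refine ⟨fun d => u (D.region d), h, fun d => ?_⟩
  have := h d.rot
  rw [D.region_edge_rot] at this
  change u _ = u _ + 1
  rw [this, add_assoc, CharTwo.add_self_eq_zero, add_zero]

/-- Both smoothings join half-edges that are an odd number of rotations apart. -/
theorem checkerboard_smooth {χ : Dart D.n D.m → ZMod 2} (h : ∀ d, χ d.rot = χ d + 1)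
    (S : D.Resolution) (d : Dart D.n D.m) : χ (smooth S d) = χ d + 1 := by
  rcases d with ⟨c, i⟩ | ⟨p, b⟩
  · have h2 : (1 + 1 : ZMod 2) = 0 := rfl
    have h1 : χ (Sum.inl (c, 1)) = χ (Sum.inl (c, 0)) + 1 := h (Sum.inl (c, 0))
    have h2 : χ (Sum.inl (c, 2)) = χ (Sum.inl (c, 1)) + 1 := h (Sum.inl (c, 1))
    have h3 : χ (Sum.inl (c, 3)) = χ (Sum.inl (c, 2)) + 1 := h (Sum.inl (c, 2))
    have e2 : (1 - 2 : ZMod 4) = 3 := rfl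
    have e3 : (1 - 3 : ZMod 4) = 2 := rfl
    have e4 : (3 - 1 : ZMod 4) = 2 := rfl
    have e5 : (3 - 2 : ZMod 4) = 1 := rfl
    have hi : i = 0 ∨ i = 1 ∨ i = 2 ∨ i = 3 := by revert i; decide
    rcases hi with rfl | rfl | rfl | rfl <;> by_cases hc : S c <;>
      simp [smooth, hc, e2, e3, e4, e5, h1, h2, h3, add_assoc, CharTwo.add_self_eq_zero]
  · exact h (Sum.inr (p, b))

end AnnularDiagram

/-! ### Permutations and transpositions. -/

/-- Composing a permutation of a finite set with a transposition splits a cycle that contains both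
points, and merges the cycles of the two points otherwise. -/
theorem Equiv.Perm.sameCycle_swap_mul_iff {α : Type*} [Finite α] [DecidableEq α]
    (σ : Equiv.Perm α) {a b : α} (hab : a ≠ b) :
    (Equiv.swap a b * σ).SameCycle a b ↔ ¬ σ.SameCycle a b := by
  -- Take the first positive time `k` at which the orbit of `a` under `σ` meets `{a, b}`. Before `k`
  -- the orbits under `σ` and `swap a b * σ` coincide, and at `k` one is at `a` and the other at
  -- `b`. The one that returns to `a` has closed up without meeting `b`.
  have hex : ∃ k : ℕ, 0 < k ∧ ((σ ^ k) a = a ∨ (σ ^ k) a = b) :=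
    ⟨orderOf σ, orderOf_pos σ, Or.inl (by rw [pow_orderOf_eq_one]; rfl)⟩
  classical
  obtain ⟨hk, hkab⟩ := Nat.find_spec hex
  have hmin : ∀ i, 0 < i → i < Nat.find hex → (σ ^ i) a ≠ a ∧ (σ ^ i) a ≠ b := fun i h0 hi => by
    have := Nat.find_min hex hi
    tauto
  generalize Nat.find hex = k at hk hkab hmin
  have hper : ∀ τ : Equiv.Perm α, (τ ^ k) a = a →
      (∀ i, 0 < i → i < k → (τ ^ i) a ≠ b) → ¬ τ.SameCycle a b := by
    intro τ h1 h2 h3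
    obtain ⟨i, hi⟩ := h3.exists_nat_pow_eq
    have hmod : (τ ^ (i % k)) a = b := by
      rw [← hi]
      conv_rhs => rw [← Nat.mod_add_div i k, pow_add, pow_mul, Equiv.Perm.mul_apply,
        Equiv.Perm.pow_apply_eq_self_of_apply_eq_self h1]
    rcases Nat.eq_zero_or_pos (i % k) with h0 | h0
    · rw [h0] at hmod
      exact hab hmod
    · exact h2 _ h0 (Nat.mod_lt _ hk) hmod
  have hlt : ∀ i, i < k → ((Equiv.swap a b * σ) ^ i) a = (σ ^ i) a := by
    intro i
    induction i with
    | zero => intro _; rfl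
    | succ i ih =>
      intro hi
      obtain ⟨h1, h2⟩ := hmin (i + 1) (Nat.succ_pos i) hi
      rw [pow_succ', Equiv.Perm.mul_apply, ih (by lia), Equiv.Perm.mul_apply,
        ← Equiv.Perm.mul_apply σ, ← pow_succ', Equiv.swap_apply_of_ne_of_ne h1 h2]
  have hlast : ((Equiv.swap a b * σ) ^ k) a = Equiv.swap a b ((σ ^ k) a) := by
    obtain ⟨k, rfl⟩ := Nat.exists_eq_succ_of_ne_zero hk.ne'
    rw [pow_succ', Equiv.Perm.mul_apply, hlt k (by lia), Equiv.Perm.mul_apply,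
        ← Equiv.Perm.mul_apply σ, ← pow_succ']
  rcases hkab with h | h
  · rw [h, Equiv.swap_apply_left] at hlast
    refine iff_of_true ⟨k, by simpa using hlast⟩ (hper σ h fun i h0 hi => (hmin i h0 hi).2)
  · rw [h, Equiv.swap_apply_right] at hlast
    refine iff_of_false (hper _ hlast fun i h0 hi => ?_) (not_not.2 ⟨k, by simpa using h⟩)
    rw [hlt i hi]
    exact (hmin i h0 hi).2

namespace AnnularDiagram

variable {D : AnnularDiagram}

theorem _root_.ZMod.eq_zero_or_one_or_two_or_three :
    ∀ i : ZMod 4, i = 0 ∨ i = 1 ∨ i = 2 ∨ i = 3 := by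
  decide

/-! ### Changing the resolution of one crossing -/

theorem circleOf_edge (S : D.Resolution) (d : Dart D.n D.m) :
    circleOf S (D.edge d) = circleOf S d :=
  Eq.symm (a := circleOf S d) (Quot.sound (Or.inl rfl))

theorem circleOf_smooth (S : D.Resolution) (d : Dart D.n D.m) :
    circleOf S (smooth S d) = circleOf S d :=
  Eq.symm (a := circleOf S d) (Quot.sound (Or.inr rfl))

/-- The permutation of the black half-edges (with respect to a checkerboard colouring) that
goes around the circles of a resolution. -/
def blackPerm {χ : Dart D.n D.m → ZMod 2} (he : ∀ d, χ (D.edge d) = χ d + 1)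
    (hr : ∀ d, χ d.rot = χ d + 1) (S : D.Resolution) : Equiv.Perm {d // χ d = 1} where
  toFun d := ⟨smooth S (D.edge d), by
    rw [checkerboard_smooth hr, he, d.2, add_assoc, CharTwo.add_self_eq_zero, add_zero]⟩
  invFun d := ⟨D.edge (smooth S d), by
    rw [he, checkerboard_smooth hr, d.2, add_assoc, CharTwo.add_self_eq_zero, add_zero]⟩
  left_inv d := Subtype.ext (by simp [smooth_smooth, D.edge_edge])
  right_inv d := Subtype.ext (by simp [smooth_smooth, D.edge_edge])

theorem circleOf_blackPerm {χ : Dart D.n D.m → ZMod 2} (he : ∀ d, χ (D.edge d) = χ d + 1)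
    (hr : ∀ d, χ d.rot = χ d + 1) (S : D.Resolution) (d : {d // χ d = 1}) :
    circleOf S (blackPerm he hr S d).1 = circleOf S d.1 :=
  (circleOf_smooth S _).trans (circleOf_edge S _)

/-- Half-edges along a circle alternate in colour. The map `ρ` moves white half-edges across their
edge to black ones; under it, `edge` becomes the identity and `smooth` one step of the permutation,
forwards or backwards. -/
theorem sameCycle_blackPerm_iff {χ : Dart D.n D.m → ZMod 2} (he : ∀ d, χ (D.edge d) = χ d + 1)
    (hr : ∀ d, χ d.rot = χ d + 1) (S : D.Resolution) (d e : {d // χ d = 1}) :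
    (blackPerm he hr S).SameCycle d e ↔ circleOf S d.1 = circleOf S e.1 := by
  constructor
  · intro h
    obtain ⟨k, rfl⟩ := h.exists_nat_pow_eq
    induction k with
    | zero => rfl
    | succ k ih =>
      rw [pow_succ', Equiv.Perm.mul_apply, circleOf_blackPerm]
      exact ih ⟨k, by simp⟩
  · intro h
    have h01 : ∀ t : ZMod 2, t ≠ 1 → t = 0 := by decide
    have hρ : ∀ d, χ d ≠ 1 → χ (D.edge d) = 1 := fun d hd => by rw [he, h01 _ hd, zero_add]
    let ρ : Dart D.n D.m → {d // χ d = 1} := fun d =>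
      if hd : χ d = 1 then ⟨d, hd⟩ else ⟨D.edge d, hρ d hd⟩
    have hρe : ∀ d, ρ (D.edge d) = ρ d := fun d => by
      by_cases hd : χ d = 1
      · have : χ (D.edge d) ≠ 1 := by rw [he, hd]; decide
        simp [ρ, hd, this, D.edge_edge]
      · simp [ρ, hd, hρ d hd]
    have hstep : ∀ d, χ d = 1 → (blackPerm he hr S).SameCycle (ρ d) (ρ (smooth S d)) :=
      fun d hd => by
        have h0 : χ (smooth S d) ≠ 1 := by rw [checkerboard_smooth hr, hd]; decide
        refine Equiv.Perm.SameCycle.symm ⟨1, Subtype.ext ?_⟩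
        simp [ρ, hd, h0, blackPerm, D.edge_edge, smooth_smooth]
    have key : ∀ d e, Relation.EqvGen (fun d d' => d' = D.edge d ∨ d' = smooth S d) d e →
        (blackPerm he hr S).SameCycle (ρ d) (ρ e) := by
      intro d e h
      induction h with
      | rel d e h =>
        rcases h with rfl | rfl
        · rw [hρe]
        · by_cases hd : χ d = 1
          · exact hstep d hd
          · have := hstep (smooth S d) (by rw [checkerboard_smooth hr, h01 _ hd, zero_add])
            rw [smooth_smooth] at this
            exact this.symm
      | refl => exact Equiv.Perm.SameCycle.refl _ _
      | symm _ _ _ ih => exact ih.symm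
      | trans _ _ _ _ _ ih ih' => exact ih.trans ih'
    have := key _ _ (Quot.eqvGen_exact h)
    simpa [ρ, d.2, e.2] using this

theorem smooth_inl_ne {S : D.Resolution} {c c' : Fin D.n} (h : c' ≠ c) (i j : ZMod 4) :
    smooth S (Sum.inl (c', i)) ≠ Sum.inl (c, j) := by
  simp [smooth, h]

/-- Changing the resolution of a crossing merges or splits circles. -/
theorem circleOf_eq_iff_not {S S' : D.Resolution} {c : Fin D.n} (hc : S c ≠ S' c)
    (h : ∀ c', c' ≠ c → S c' = S' c') :
    circleOf S' (Sum.inl (c, 0)) = circleOf S' (Sum.inl (c, 2)) ↔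
      ¬ circleOf S (Sum.inl (c, 0)) = circleOf S (Sum.inl (c, 2)) := by
  -- Adding a constant to a checkerboard colouring makes the half-edges `0` and `2` at `c` black.
  obtain ⟨χ, he, hr, h1⟩ : ∃ χ : Dart D.n D.m → ZMod 2, (∀ d, χ (D.edge d) = χ d + 1) ∧
      (∀ d, χ d.rot = χ d + 1) ∧ χ (Sum.inl (c, 0)) = 1 := by
    obtain ⟨χ, he, hr⟩ := D.exists_checkerboard
    refine ⟨fun d => χ d + χ (Sum.inl (c, 0)) + 1, fun d => ?_, fun d => ?_, ?_⟩
    · simp only [he]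
      ring
    · simp only [hr]
      ring
    · simp only [CharTwo.add_self_eq_zero, zero_add]
  have h2 : χ (Sum.inl (c, 1)) = 0 := (hr (Sum.inl (c, 0))).trans (by rw [h1]; rfl)
  have h3 : χ (Sum.inl (c, 2)) = 1 := (hr (Sum.inl (c, 1))).trans (by rw [h2]; rfl)
  have h4 : χ (Sum.inl (c, 3)) = 0 := (hr (Sum.inl (c, 2))).trans (by rw [h3]; rfl)
  let p : {d // χ d = 1} := ⟨Sum.inl (c, 0), h1⟩
  let q : {d // χ d = 1} := ⟨Sum.inl (c, 2), h3⟩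
  have hpq : p ≠ q := fun hpq => by
    have : (0 : ZMod 4) = 2 := by simpa [p, q] using hpq
    revert this
    decide
  classical
  -- At `c`, smoothing sends the white half-edges `1`, `3` to the black ones `0`, `2`, in the two
  -- possible orders for the two resolutions. Elsewhere nothing changes.
  have hmul : blackPerm he hr S' = Equiv.swap p q * blackPerm he hr S := by
    ext d
    rw [Equiv.Perm.mul_apply]
    have hd : χ (D.edge d) = 0 := by rw [he, d.2]; rfl
    have e1 : (1 - 1 : ZMod 4) = 0 := rfl
    have e3 : (1 - 3 : ZMod 4) = 2 := rfl
    have e4 : (3 - 1 : ZMod 4) = 2 := rfl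
    have e6 : (3 - 3 : ZMod 4) = 0 := rfl
    have hval : ∀ T : D.Resolution, (blackPerm he hr T d).1 = smooth T (D.edge d) := fun _ => rfl
    rcases hed : D.edge d with ⟨c', i⟩ | ⟨k, b⟩
    · by_cases hcc : c' = c
      · subst hcc
        rw [hed] at hd
        have hi : i = 1 ∨ i = 3 := by
          have hi := ZMod.eq_zero_or_one_or_two_or_three i
          rcases hi with rfl | rfl | rfl | rfl
          · rw [h1] at hd
            exact absurd hd one_ne_zero
          · exact Or.inl rfl
          · rw [h3] at hd
            exact absurd hd one_ne_zero
          · exact Or.inr rfl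
        have hp : ∀ T : D.Resolution, smooth T (Sum.inl (c', i)) = Sum.inl (c', 0) →
            blackPerm he hr T d = p := fun T hT => Subtype.ext (by rw [hval, hed, hT])
        have hq : ∀ T : D.Resolution, smooth T (Sum.inl (c', i)) = Sum.inl (c', 2) →
            blackPerm he hr T d = q := fun T hT => Subtype.ext (by rw [hval, hed, hT])
        have hcases : ∀ T : D.Resolution, T c' = true ∨ T c' = false := fun T => by simp
        have hS0 : ∀ T : D.Resolution, T c' = false →
            smooth T (Sum.inl (c', i)) = Sum.inl (c', 1 - i) := fun T hT => by simp [smooth, hT]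
        have hS1 : ∀ T : D.Resolution, T c' = true →
            smooth T (Sum.inl (c', i)) = Sum.inl (c', 3 - i) := fun T hT => by simp [smooth, hT]
        have hswap : blackPerm he hr S d = p ∧ blackPerm he hr S' d = q ∨
            blackPerm he hr S d = q ∧ blackPerm he hr S' d = p := by
          rcases hcases S with hS | hS <;> rcases hcases S' with hS' | hS'
          · exact absurd (hS.trans hS'.symm) hc
          · rcases hi with rfl | rfl
            · exact Or.inr ⟨hq _ (by rw [hS1 _ hS, e4]), hp _ (by rw [hS0 _ hS', e1])⟩
            · exact Or.inl ⟨hp _ (by rw [hS1 _ hS, e6]), hq _ (by rw [hS0 _ hS', e3])⟩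
          · rcases hi with rfl | rfl
            · exact Or.inl ⟨hp _ (by rw [hS0 _ hS, e1]), hq _ (by rw [hS1 _ hS', e4])⟩
            · exact Or.inr ⟨hq _ (by rw [hS0 _ hS, e3]), hp _ (by rw [hS1 _ hS', e6])⟩
          · exact absurd (hS.trans hS'.symm) hc
        rcases hswap with ⟨h1, h2⟩ | ⟨h1, h2⟩
        · rw [h1, h2, Equiv.swap_apply_left]
        · rw [h1, h2, Equiv.swap_apply_right]
      · rw [Equiv.swap_apply_of_ne_of_ne]
        · rw [hval, hval, hed, smooth, smooth, h c' hcc]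
        · exact fun h' => smooth_inl_ne hcc i 0 (by rw [← hed, ← hval]; exact congrArg _ h')
        · exact fun h' => smooth_inl_ne hcc i 2 (by rw [← hed, ← hval]; exact congrArg _ h')
    · have hne : ∀ j, smooth S (Sum.inr (k, b)) ≠ Sum.inl (c, j) := fun j => by simp [smooth]
      rw [Equiv.swap_apply_of_ne_of_ne]
      · rw [hval, hval, hed, smooth, smooth]
      · exact fun h' => hne 0 (by rw [← hed, ← hval]; exact congrArg _ h')
      · exact fun h' => hne 2 (by rw [← hed, ← hval]; exact congrArg _ h')
  have := (blackPerm he hr S).sameCycle_swap_mul_iff hpq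
  rw [← hmul, sameCycle_blackPerm_iff, sameCycle_blackPerm_iff] at this
  exact this

/-- The circle through `d` passes through the crossing `c`. -/
def Touches (S : D.Resolution) (c : Fin D.n) (d : Dart D.n D.m) : Prop :=
  circleOf S d = circleOf S (Sum.inl (c, 0)) ∨ circleOf S d = circleOf S (Sum.inl (c, 2))

theorem touches_crossing (S : D.Resolution) (c : Fin D.n) (i : ZMod 4) :
    Touches S c (Sum.inl (c, i)) := by
  have hi := ZMod.eq_zero_or_one_or_two_or_three i
  have e2 : (1 - 1 : ZMod 4) = 0 := rfl
  have e3 : (1 - 3 : ZMod 4) = 2 := rfl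
  have e4 : (3 - 1 : ZMod 4) = 2 := rfl
  have e6 : (3 - 3 : ZMod 4) = 0 := rfl
  rcases hi with rfl | rfl | rfl | rfl
  · exact Or.inl rfl
  · have := circleOf_smooth S (Sum.inl (c, 1))
    by_cases h : S c <;>
      simp only [smooth, h, e2, e4, if_true, if_false, Bool.false_eq_true] at this
    · exact Or.inr this.symm
    · exact Or.inl this.symm
  · exact Or.inr rfl
  · have := circleOf_smooth S (Sum.inl (c, 3))
    by_cases h : S c <;>
      simp only [smooth, h, e3, e6, if_true, if_false, Bool.false_eq_true] at this
    · exact Or.inl this.symm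
    · exact Or.inr this.symm

theorem Touches.congr {S : D.Resolution} {c : Fin D.n} {d e : Dart D.n D.m}
    (h : circleOf S d = circleOf S e) : Touches S c d ↔ Touches S c e := by
  rw [Touches, Touches, h]

/-- How the circles of two resolutions that differ at one crossing are related. -/
theorem circleOf_eq_iff {S S' : D.Resolution} {c : Fin D.n}
    (h : ∀ c', c' ≠ c → S c' = S' c')
    (h' : circleOf S' (Sum.inl (c, 0)) = circleOf S' (Sum.inl (c, 2))) (d e : Dart D.n D.m) :
    circleOf S' d = circleOf S' e ↔
      circleOf S d = circleOf S e ∨ (Touches S c d ∧ Touches S c e) := by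
  have hsm : ∀ d : Dart D.n D.m, smooth S' d = smooth S d ∨
      ∃ i j, d = Sum.inl (c, i) ∧ smooth S' d = Sum.inl (c, j) := by
    rintro (⟨c', i⟩ | ⟨p, b⟩)
    · by_cases hcc : c' = c
      · subst hcc
        exact Or.inr ⟨_, _, rfl, rfl⟩
      · left
        rw [smooth, smooth, h c' hcc]
    · exact Or.inl rfl
  have hall : ∀ i j, circleOf S' (Sum.inl (c, i)) = circleOf S' (Sum.inl (c, j)) := fun i j => by
    have hi : ∀ i, circleOf S' (Sum.inl (c, i)) = circleOf S' (Sum.inl (c, 0)) := fun i =>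
      (touches_crossing S' c i).elim id fun hi => hi.trans h'.symm
    rw [hi, hi j]
  have hle : ∀ d e, circleOf S d = circleOf S e → circleOf S' d = circleOf S' e := by
    intro d e hde
    refine congrArg (Quot.lift (circleOf S') ?_) hde
    rintro d _ (rfl | rfl)
    · exact (circleOf_edge _ _).symm
    · rcases hsm d with hd | ⟨i, j, rfl, -⟩
      · rw [← hd, circleOf_smooth]
      · exact hall _ _
  constructor
  · intro hde
    have := Quot.eqvGen_exact hde
    clear hde
    induction this with
    | rel d e hde =>
      rcases hde with rfl | rfl
      · exact Or.inl (circleOf_edge _ _).symm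
      · rcases hsm d with hd | ⟨i, j, rfl, hj⟩
        · left
          rw [hd, circleOf_smooth]
        · right
          rw [hj]
          exact ⟨touches_crossing _ _ _, touches_crossing _ _ _⟩
    | refl => exact Or.inl rfl
    | symm _ _ _ ih => exact ih.imp Eq.symm And.symm
    | trans d e f _ _ ih ih' =>
      rcases ih with ih | ⟨h1, h2⟩
      · rcases ih' with ih' | ⟨h1', h2'⟩
        · exact Or.inl (ih.trans ih')
        · exact Or.inr ⟨(Touches.congr ih).2 h1', h2'⟩
      · rcases ih' with ih' | ⟨h1', h2'⟩
        · exact Or.inr ⟨h1, (Touches.congr ih').1 h2⟩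
        · exact Or.inr ⟨h1, h2'⟩
  · rintro (hde | ⟨hd, he⟩)
    · exact hle d e hde
    · have ht : ∀ d, Touches S c d → circleOf S' d = circleOf S' (Sum.inl (c, 0)) := fun d hd =>
        hd.elim (hle _ _) fun hd => (hle _ _ hd).trans h'.symm
      rw [ht d hd, ht e he]

theorem touches_iff {S S' : D.Resolution} {c : Fin D.n} (h : ∀ c', c' ≠ c → S c' = S' c')
    (h' : circleOf S' (Sum.inl (c, 0)) = circleOf S' (Sum.inl (c, 2))) (d : Dart D.n D.m) :
    Touches S' c d ↔ Touches S c d := by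
  rw [Touches, ← h', or_self, circleOf_eq_iff h h']
  have := touches_crossing S c 0
  unfold Touches at *
  tauto

end AnnularDiagram

namespace AnnularDiagram

variable {D : AnnularDiagram}

/-! ### Signs of enhanced states -/

namespace EnhancedState

theorem sign_congr (x : D.EnhancedState) {d e : Dart D.n D.m}
    (h : circleOf x.1 d = circleOf x.1 e) : x.sign d = x.sign e := congrArg x.2 h

theorem ext_sign {x y : D.EnhancedState} (h : x.1 = y.1) (hs : ∀ d, x.sign d = y.sign d) :
    x = y := by
  obtain ⟨S, s⟩ := x
  obtain ⟨S', t⟩ := y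
  obtain rfl : S = S' := h
  congr 1
  ext C
  obtain ⟨d, rfl⟩ := Quot.mk_surjective C
  exact hs d

open Classical in
/-- Change the sign of the circle through `d` to `b`. -/
def setSign (x : D.EnhancedState) (d : Dart D.n D.m) (b : Bool) : D.EnhancedState :=
  ⟨x.1, Function.update x.2 (circleOf x.1 d) b⟩

theorem setSign_fst (x : D.EnhancedState) (d : Dart D.n D.m) (b : Bool) :
    (x.setSign d b).1 = x.1 := rfl

open Classical in
theorem sign_setSign (x : D.EnhancedState) (d e : Dart D.n D.m) (b : Bool) :
    (x.setSign d b).sign e = if circleOf x.1 e = circleOf x.1 d then b else x.sign e := by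
  by_cases h : circleOf x.1 e = circleOf x.1 d <;> simp [setSign, sign, h]

theorem sign_setSign_of_eq (x : D.EnhancedState) {d e : Dart D.n D.m} (b : Bool)
    (h : circleOf x.1 e = circleOf x.1 d) : (x.setSign d b).sign e = b := by
  rw [sign_setSign, if_pos h]

theorem sign_setSign_of_ne (x : D.EnhancedState) {d e : Dart D.n D.m} (b : Bool)
    (h : circleOf x.1 e ≠ circleOf x.1 d) : (x.setSign d b).sign e = x.sign e := by
  rw [sign_setSign, if_neg h]

theorem setSign_setSign_same (x : D.EnhancedState) (d : Dart D.n D.m) (b b' : Bool) :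
    (x.setSign d b).setSign d b' = x.setSign d b' := by
  refine ext_sign rfl fun f => ?_
  by_cases h : circleOf x.1 f = circleOf x.1 d <;> simp [sign_setSign, setSign_fst, h]

theorem setSign_eq_self (x : D.EnhancedState) (d : Dart D.n D.m) :
    x.setSign d (x.sign d) = x := by
  simp [setSign, sign]

theorem setSign_congr (x : D.EnhancedState) {d e : Dart D.n D.m} (b : Bool)
    (h : circleOf x.1 d = circleOf x.1 e) : x.setSign d b = x.setSign e b := by
  rw [setSign, setSign, h]

theorem setSign_comm (x : D.EnhancedState) (d e : Dart D.n D.m) (b : Bool) :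
    (x.setSign d b).setSign e b = (x.setSign e b).setSign d b := by
  refine ext_sign rfl fun f => ?_
  simp only [sign_setSign, setSign_fst]
  grind

end EnhancedState

open EnhancedState

/-! ### Merge and split maps against the operators `v₊ ↦ v₋`. -/

theorem update_ne_iff {S S' : D.Resolution} {c : Fin D.n} (h0 : S c = false)
    (h1 : S' = Function.update S c true) :
    S c ≠ S' c ∧ ∀ c', c' ≠ c → S c' = S' c' := by
  subst h1
  refine ⟨by simp [h0], fun c' hc => by simp [hc]⟩

theorem mulRule_iff {a b r : Bool} :
    MulRule a b r ↔ (a = true ∨ b = true) ∧ r = (a && b) := by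
  cases a <;> cases b <;> simp [MulRule]

theorem comulRule_iff {a r s : Bool} :
    ComulRule a r s ↔ (r = false ∨ s = false) ∧ a = (r || s) := by
  cases a <;> cases r <;> cases s <;> simp [ComulRule]

/-- `Occurs` when two circles are merged. -/
theorem occurs_iff_of_merge {c : Fin D.n} {x y : D.EnhancedState} (hx : x.1 c = false)
    (hy : y.1 = Function.update x.1 c true) (h : ¬ x.OneCircleAt c) :
    Occurs c x y ↔ (∀ d, ¬ Touches x.1 c d → y.sign d = x.sign d) ∧
      MulRule (x.sign (Sum.inl (c, 0))) (x.sign (Sum.inl (c, 2))) (y.sign (Sum.inl (c, 0))) := by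
  have h1 := update_ne_iff hx hy
  have h' : y.OneCircleAt c := (circleOf_eq_iff_not h1.1 h1.2).2 h
  simp only [Occurs, Touches, not_or, and_imp]
  tauto

/-- `Occurs` when a circle is split. -/
theorem occurs_iff_of_split {c : Fin D.n} {x y : D.EnhancedState} (hx : x.1 c = false)
    (hy : y.1 = Function.update x.1 c true) (h : x.OneCircleAt c) :
    Occurs c x y ↔ (∀ d, ¬ Touches x.1 c d → y.sign d = x.sign d) ∧
      ComulRule (x.sign (Sum.inl (c, 0))) (y.sign (Sum.inl (c, 0))) (y.sign (Sum.inl (c, 2))) := by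
  have h1 := update_ne_iff hx hy
  have h' : ¬ y.OneCircleAt c := fun h2 => (circleOf_eq_iff_not h1.1 h1.2).1 h2 h
  simp only [Occurs, Touches, not_or, and_imp]
  tauto

/-- The maps `d_{S,S'}` commute with the operators `v₊ ↦ v₋`, `v₋ ↦ 0` at half-edges. -/
theorem occurs_setSign_iff (c : Fin D.n) (x y : D.EnhancedState) (d : Dart D.n D.m) :
    (x.sign d = true ∧ Occurs c (x.setSign d false) y) ↔
      (y.sign d = false ∧ Occurs c x (y.setSign d true)) := by
  -- The two sides say that the matrix entry from `x` to `y` is nonzero when the lowering operator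
  -- is applied before, respectively after, the edge map.
  by_cases hx : x.1 c = false
  swap
  · exact iff_of_false (fun h => hx h.2.1) (fun h => hx h.2.1)
  by_cases hy : y.1 = Function.update x.1 c true
  swap
  · exact iff_of_false (fun h => hy h.2.2.1) (fun h => hy h.2.2.1)
  have h1 := update_ne_iff hx hy
  have hsx : ∀ e, circleOf x.1 e = circleOf x.1 d → _ := fun _ => x.sign_congr
  have hsy : ∀ e, circleOf y.1 e = circleOf y.1 d → _ := fun _ => y.sign_congr
  by_cases h : x.OneCircleAt c
  · have h' : ¬ y.OneCircleAt c := fun h2 => (circleOf_eq_iff_not h1.1 h1.2).1 h2 h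
    -- Everything is expressed by the finer partition into circles, here that of `y`; what remains
    -- is a finite check of signs.
    have hr := circleOf_eq_iff (fun c' hc => (h1.2 c' hc).symm) h
    have ht := touches_iff (fun c' hc => (h1.2 c' hc).symm) h
    have hp := touches_crossing y.1 c 0
    have hq := touches_crossing y.1 c 2
    rw [occurs_iff_of_split (x := x.setSign d false) hx hy h,
      occurs_iff_of_split (y := y.setSign d true) hx hy h]
    simp only [comulRule_iff, sign_setSign, setSign_fst, hr, ht]
    unfold Touches OneCircleAt at *
    constructor
    · rintro ⟨hd, h2, h3⟩
      grind
    · rintro ⟨hd, h2, h3⟩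
      grind
  · have h' : y.OneCircleAt c := (circleOf_eq_iff_not h1.1 h1.2).2 h
    have hr := circleOf_eq_iff h1.2 h'
    have ht := touches_iff h1.2 h'
    have hp := touches_crossing x.1 c 0
    have hq := touches_crossing x.1 c 2
    rw [occurs_iff_of_merge (x := x.setSign d false) hx hy h,
      occurs_iff_of_merge (y := y.setSign d true) hx hy h]
    simp only [mulRule_iff, sign_setSign, setSign_fst, hr]
    unfold Touches OneCircleAt at *
    constructor
    · rintro ⟨hd, h2, h3⟩
      grind
    · rintro ⟨hd, h2, h3⟩
      grind

end AnnularDiagram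

namespace AnnularDiagram

variable {D : AnnularDiagram} (R : Type u) [CommRing R]

open EnhancedState

instance : Fintype D.EnhancedState := Fintype.ofFinite _

/-! ### The differential on the total Khovanov complex -/

variable (D) in
/-- The sum of all `CKh^{i,j}(D)`. -/
abbrev TotalCKh : Type u := D.EnhancedState →₀ R

open Classical in
/-- The sum of the maps `d_{S,S'}` over all pairs that differ at the crossing `c`. -/
def crossingMap (c : Fin D.n) : D.TotalCKh R →ₗ[R] D.TotalCKh R :=
  Finsupp.linearCombination R fun x : D.EnhancedState =>
    ∑ y : D.EnhancedState, if Occurs c x y then Finsupp.single y 1 else 0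

/-- The operator `v₊ ↦ v₋`, `v₋ ↦ 0` on the circle through a half-edge. -/
def lowerMap (d : Dart D.n D.m) : D.TotalCKh R →ₗ[R] D.TotalCKh R :=
  Finsupp.linearCombination R fun x : D.EnhancedState =>
    if x.sign d = true then Finsupp.single (x.setSign d false) 1 else 0

variable {R}

open Classical in
theorem crossingMap_single (c : Fin D.n) (x : D.EnhancedState) :
    crossingMap R c (Finsupp.single x 1) = ∑ y, if Occurs c x y then Finsupp.single y 1 else 0 := by
  simp [crossingMap]

open Classical in
theorem crossingMap_single_apply (c : Fin D.n) (x z : D.EnhancedState) :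
    crossingMap R c (Finsupp.single x 1) z = if Occurs c x z then 1 else 0 := by
  rw [crossingMap_single, Finsupp.finsetSum_apply, Finset.sum_eq_single z]
  · split_ifs <;> simp
  · intro y _ hy
    split_ifs <;> simp [hy]
  · simp

theorem lowerMap_single (d : Dart D.n D.m) (x : D.EnhancedState) :
    lowerMap R d (Finsupp.single x 1) =
      if x.sign d = true then Finsupp.single (x.setSign d false) 1 else 0 := by
  simp [lowerMap]

/-- The lowering operator is multiplication by `X` at a base point, and `m` and `Δ` are linear over
`R[X]/(X²)`. -/
theorem crossingMap_lowerMap (c : Fin D.n) (d : Dart D.n D.m) (v : D.TotalCKh R) :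
    crossingMap R c (lowerMap R d v) = lowerMap R d (crossingMap R c v) := by
  classical
  suffices h : crossingMap R c ∘ₗ lowerMap R d = lowerMap R d ∘ₗ crossingMap R c from
    LinearMap.congr_fun h v
  refine Finsupp.lhom_ext' fun x => LinearMap.ext_ring ?_
  simp only [LinearMap.comp_apply, Finsupp.lsingle_apply]
  ext z
  have hL : crossingMap R c (lowerMap R d (Finsupp.single x 1)) z =
      if x.sign d = true ∧ Occurs c (x.setSign d false) z then 1 else 0 := by
    rw [lowerMap_single]
    by_cases h : x.sign d = true
    · simp only [h, if_true, true_and, crossingMap_single_apply]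
    · simp [h]
  -- The only generator that can be lowered to `z` is `z` with `v₊` put on the circle through `d`.
  rw [hL, crossingMap_single, map_sum, Finsupp.finsetSum_apply,
    Finset.sum_eq_single (z.setSign d true)]
  · have hz : (z.setSign d true).sign d = true := sign_setSign_of_eq _ _ rfl
    simp only [apply_ite (lowerMap R d), lowerMap_single, hz, if_true, map_zero,
      setSign_setSign_same, occurs_setSign_iff]
    by_cases h : z.sign d = false
    · have hz' : z.setSign d false = z := by
        conv_rhs => rw [← z.setSign_eq_self d, h]
      rw [hz']
      by_cases h' : Occurs c x (z.setSign d true) <;> simp [h, h']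
    · have hz' : z.setSign d false ≠ z := fun hz' => h (by
        rw [← hz']
        exact sign_setSign_of_eq _ _ rfl)
      by_cases h' : Occurs c x (z.setSign d true) <;> simp [h, h', hz']
  · intro y _ hy
    split_ifs with h
    · rw [lowerMap_single]
      split_ifs with h'
      · refine Finsupp.single_eq_of_ne ?_
        rintro rfl
        refine hy ?_
        rw [setSign_setSign_same]
        conv_lhs => rw [← y.setSign_eq_self d, h']
      · rfl
    · simp
  · simp

theorem lowerMap_comm (d e : Dart D.n D.m) (v : D.TotalCKh R) :
    lowerMap R d (lowerMap R e v) = lowerMap R e (lowerMap R d v) := by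
  suffices h : lowerMap R d ∘ₗ lowerMap R e = lowerMap R e ∘ₗ lowerMap R d from
    LinearMap.congr_fun h v
  refine Finsupp.lhom_ext' fun x => LinearMap.ext_ring ?_
  simp only [LinearMap.comp_apply, Finsupp.lsingle_apply]
  classical
  -- Lowering twice on the same circle gives zero, since `X² = 0`; this makes the formula symmetric
  -- in `d` and `e`.
  have h : ∀ d e : Dart D.n D.m, lowerMap R d (lowerMap R e (Finsupp.single x 1)) =
      if x.sign d = true ∧ x.sign e = true ∧ circleOf x.1 d ≠ circleOf x.1 e then
        Finsupp.single ((x.setSign e false).setSign d false) 1 else 0 := by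
    intro d e
    rw [lowerMap_single]
    by_cases he : x.sign e = true
    · rw [if_pos he, lowerMap_single, sign_setSign]
      by_cases hde : circleOf x.1 d = circleOf x.1 e <;> simp [hde, he]
    · simp [he]
  rw [h, h, setSign_comm]
  refine if_congr ?_ rfl rfl
  rw [ne_comm]
  tauto

/-! ### Generators with all signs `v₊`. -/

/-- The enhanced state with the sign `v₊` on all circles. -/
def topState (S : D.Resolution) : D.EnhancedState := ⟨S, fun _ => true⟩

theorem topState_sign (S : D.Resolution) (d : Dart D.n D.m) : (topState S).sign d = true := rfl

variable (R) in
/-- The generator with the sign `v₊` on all circles. -/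
def topGen (S : D.Resolution) : D.TotalCKh R := Finsupp.single (topState S) 1

/-- All generators are obtained from the ones with signs `v₊` by the operators `v₊ ↦ v₋`. -/
theorem single_induction {P : D.TotalCKh R → Prop} (S : D.Resolution) (h : P (topGen R S))
    (hl : ∀ d v, P v → P (lowerMap R d v)) (s : Circle S → Bool) :
    P (Finsupp.single ⟨S, s⟩ 1) := by
  classical
  have key : ∀ t : Finset (Circle S), P (Finsupp.single ⟨S, fun C => decide (C ∉ t)⟩ 1) := by
    intro t
    induction t using Finset.induction_on with
    | empty => simpa [topGen, topState] using h
    | insert C t hC ih =>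
      obtain ⟨d, rfl⟩ : ∃ d, circleOf S d = C := Quot.mk_surjective C
      have := hl d _ ih
      have hd : EnhancedState.sign ⟨S, fun C => decide (C ∉ t)⟩ d = true := by
        simpa only [EnhancedState.sign, decide_eq_true_eq] using hC
      rw [lowerMap_single, if_pos hd] at this
      convert this using 2
      refine congrArg _ (funext fun C => ?_)
      by_cases h' : C = circleOf S d
      · subst h'
        simp
      · simp [h']
  have := key (Finset.univ.filter fun C => s C = false)
  simpa using this

theorem lowerMap_topGen_congr {S : D.Resolution} {d e : Dart D.n D.m}
    (h : circleOf S d = circleOf S e) : lowerMap R d (topGen R S) = lowerMap R e (topGen R S) := by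
  rw [topGen, lowerMap_single, lowerMap_single, topState_sign, topState_sign,
    setSign_congr (topState S) false h]

theorem crossingMap_single_of_true {x : D.EnhancedState} {c : Fin D.n} (h : x.1 c = true) :
    crossingMap R c (Finsupp.single x 1) = 0 := by
  classical
  ext z
  rw [crossingMap_single_apply, if_neg]
  · rfl
  · rintro ⟨h', -⟩
    simp [h] at h'

theorem crossingMap_topGen_of_merge {S : D.Resolution} {c : Fin D.n} (hc : S c = false)
    (h : circleOf S (Sum.inl (c, 0)) ≠ circleOf S (Sum.inl (c, 2))) :
    crossingMap R c (topGen R S) = topGen R (Function.update S c true) := by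
  classical
  ext z
  rw [topGen, crossingMap_single_apply, topGen, Finsupp.single_apply]
  refine if_congr ?_ rfl rfl
  by_cases hz : z.1 = Function.update S c true
  swap
  · refine iff_of_false (fun h' => hz h'.2.1) fun h' => hz (by rw [← h']; rfl)
  rw [occurs_iff_of_merge (x := topState S) hc hz h, mulRule_iff]
  constructor
  · rintro ⟨h1, -, h2⟩
    refine ext_sign hz.symm fun d => ?_
    rw [topState_sign]
    by_cases hd : Touches S c d
    · have h' := (circleOf_eq_iff_not (update_ne_iff hc hz).1 (update_ne_iff hc hz).2).2 h
      rw [← touches_iff (update_ne_iff hc hz).2 h', Touches, ← h', or_self] at hd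
      rw [z.sign_congr hd, h2]
      rfl
    · exact (h1 d hd).symm
  · rintro rfl
    simp [topState_sign]

theorem setSign_topState_eq_iff {x : D.EnhancedState} {d : Dart D.n D.m} :
    (topState x.1).setSign d false = x ↔
      ∀ e, x.sign e = false ↔ circleOf x.1 e = circleOf x.1 d := by
  classical
  constructor
  · intro h e
    by_cases he : circleOf x.1 e = circleOf x.1 d
    · refine iff_of_true ?_ he
      rw [← h]
      exact sign_setSign_of_eq (topState x.1) _ he
    · refine iff_of_false ?_ he
      rw [← h, sign_setSign_of_ne (topState x.1) _ he, topState_sign]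
      decide
  · intro h
    refine ext_sign rfl fun e => ?_
    rw [sign_setSign, topState_sign]
    by_cases he : circleOf x.1 e = circleOf x.1 d
    · rw [(h e).2 he]
      exact if_pos he
    · rw [Bool.eq_true_of_not_eq_false (mt (h e).1 he)]
      exact if_neg he

theorem occurs_topState_iff_of_split {S : D.Resolution} {c : Fin D.n} (hc : S c = false)
    {z : D.EnhancedState} (hz : z.1 = Function.update S c true)
    (h : circleOf S (Sum.inl (c, 0)) = circleOf S (Sum.inl (c, 2))) :
    Occurs c (topState S) z ↔ (topState z.1).setSign (Sum.inl (c, 0)) false = z ∨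
      (topState z.1).setSign (Sum.inl (c, 2)) false = z := by
  have hS := update_ne_iff hc hz
  have h' : ¬ circleOf z.1 (Sum.inl (c, 0)) = circleOf z.1 (Sum.inl (c, 2)) :=
    fun h' => (circleOf_eq_iff_not hS.1 hS.2).1 h' h
  have ht := touches_iff (fun c' hc => (hS.2 c' hc).symm) h
  have ht' : ∀ d, Touches (topState S).1 c d ↔ Touches z.1 c d := ht
  have hsign : ∀ d e, circleOf z.1 d = circleOf z.1 e → _ := fun d e h => z.sign_congr h
  rw [setSign_topState_eq_iff, setSign_topState_eq_iff,
    occurs_iff_of_split (x := topState S) hc hz h, comulRule_iff]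
  simp only [topState_sign, ht']
  simp only [Touches]
  generalize (Sum.inl (c, 0) : Dart D.n D.m) = p at *
  generalize (Sum.inl (c, 2) : Dart D.n D.m) = q at *
  clear ht ht' hS h hz
  constructor
  · rintro ⟨h1, h2 | h2, h3⟩
    · exact Or.inl fun e => by grind
    · exact Or.inr fun e => by grind
  · rintro (h1 | h1)
    · exact ⟨fun d hd => by grind, by grind, by grind⟩
    · exact ⟨fun d hd => by grind, by grind, by grind⟩

/-- This is `Δ v₊ = v₋ ⊗ v₊ + v₊ ⊗ v₋`, written with lowering operators so that a second edge map
can be moved past them. -/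
theorem crossingMap_topGen_of_split {S : D.Resolution} {c : Fin D.n} (hc : S c = false)
    (h : circleOf S (Sum.inl (c, 0)) = circleOf S (Sum.inl (c, 2))) :
    crossingMap R c (topGen R S) =
      lowerMap R (Sum.inl (c, 0)) (topGen R (Function.update S c true)) +
      lowerMap R (Sum.inl (c, 2)) (topGen R (Function.update S c true)) := by
  classical
  ext z
  rw [topGen, crossingMap_single_apply, topGen, lowerMap_single, lowerMap_single, topState_sign,
    topState_sign, if_pos rfl, if_pos rfl, Finsupp.add_apply, Finsupp.single_apply,
    Finsupp.single_apply]
  by_cases hz : z.1 = Function.update S c true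
  · have hS := update_ne_iff hc hz
    rw [← hz, if_congr (occurs_topState_iff_of_split hc hz h) rfl rfl]
    by_cases h1 : (topState z.1).setSign (Sum.inl (c, 0)) false = z
    · have h2 : ¬ (topState z.1).setSign (Sum.inl (c, 2)) false = z := fun h2 =>
        (circleOf_eq_iff_not hS.1 hS.2).1 ((setSign_topState_eq_iff.1 h2 _).1
          ((setSign_topState_eq_iff.1 h1 _).2 rfl)) h
      simp [h1, h2]
    · simp [h1]
  · have h1 : ∀ d, (topState (Function.update S c true)).setSign d false ≠ z :=
      fun d h1 => hz (by rw [← h1]; rfl)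
    rw [if_neg (h1 _), if_neg (h1 _), if_neg fun h' => hz h'.2.1, add_zero]

end AnnularDiagram

namespace AnnularDiagram

variable {D : AnnularDiagram} {R : Type u} [CommRing R]

open EnhancedState

/-! ### Commuting faces of the cube of resolutions. -/

/-- The four resolutions of two crossings. -/
theorem square_cases {S S₁ S₂ S₁₂ : D.Resolution} {c c' : Fin D.n}
    (h₁ : S c ≠ S₁ c ∧ ∀ b, b ≠ c → S b = S₁ b) (h₂ : S c' ≠ S₂ c' ∧ ∀ b, b ≠ c' → S b = S₂ b)
    (h₁₂ : S₁ c' ≠ S₁₂ c' ∧ ∀ b, b ≠ c' → S₁ b = S₁₂ b)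
    (h₂₁ : S₂ c ≠ S₁₂ c ∧ ∀ b, b ≠ c → S₂ b = S₁₂ b) :
    (circleOf S (Sum.inl (c, 0)) = circleOf S (Sum.inl (c, 2)) →
      circleOf S₁ (Sum.inl (c', 0)) = circleOf S₁ (Sum.inl (c', 2)) →
      circleOf S (Sum.inl (c', 0)) = circleOf S (Sum.inl (c', 2)) ∧
      circleOf S₂ (Sum.inl (c, 0)) = circleOf S₂ (Sum.inl (c, 2))) ∧
    (circleOf S (Sum.inl (c, 0)) ≠ circleOf S (Sum.inl (c, 2)) →
      circleOf S₁ (Sum.inl (c', 0)) ≠ circleOf S₁ (Sum.inl (c', 2)) →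
      circleOf S (Sum.inl (c', 0)) ≠ circleOf S (Sum.inl (c', 2)) ∧
      circleOf S₂ (Sum.inl (c, 0)) ≠ circleOf S₂ (Sum.inl (c, 2))) ∧
    (circleOf S (Sum.inl (c, 0)) = circleOf S (Sum.inl (c, 2)) →
      circleOf S₁ (Sum.inl (c', 0)) ≠ circleOf S₁ (Sum.inl (c', 2)) →
      circleOf S (Sum.inl (c', 0)) = circleOf S (Sum.inl (c', 2)) →
      circleOf S₂ (Sum.inl (c, 0)) ≠ circleOf S₂ (Sum.inl (c, 2)) →
      circleOf S₁₂ (Sum.inl (c, 0)) = circleOf S₁₂ (Sum.inl (c', 0)) ∧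
      circleOf S₁₂ (Sum.inl (c, 2)) = circleOf S₁₂ (Sum.inl (c', 2))) ∧
    (circleOf S (Sum.inl (c, 0)) ≠ circleOf S (Sum.inl (c, 2)) →
      circleOf S₁ (Sum.inl (c', 0)) = circleOf S₁ (Sum.inl (c', 2)) →
      circleOf S (Sum.inl (c', 0)) ≠ circleOf S (Sum.inl (c', 2)) →
      circleOf S₂ (Sum.inl (c, 0)) = circleOf S₂ (Sum.inl (c, 2)) →
      (circleOf S₁₂ (Sum.inl (c, 0)) = circleOf S₁₂ (Sum.inl (c', 0)) ∧
      circleOf S₁₂ (Sum.inl (c, 2)) = circleOf S₁₂ (Sum.inl (c', 2))) ∨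
      (circleOf S₁₂ (Sum.inl (c, 0)) = circleOf S₁₂ (Sum.inl (c', 2)) ∧
      circleOf S₁₂ (Sum.inl (c, 2)) = circleOf S₁₂ (Sum.inl (c', 0)))) := by
  have e1 := circleOf_eq_iff_not h₁.1 h₁.2
  have e2 := circleOf_eq_iff_not h₂.1 h₂.2
  have e12 := circleOf_eq_iff_not h₁₂.1 h₁₂.2
  have e21 := circleOf_eq_iff_not h₂₁.1 h₂₁.2
  have f1 := circleOf_eq_iff h₁.2
  have f2 := circleOf_eq_iff h₂.2
  have f12 := circleOf_eq_iff h₁₂.2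
  have f21 := circleOf_eq_iff h₂₁.2
  have g1 := circleOf_eq_iff fun b hb => (h₁.2 b hb).symm
  have g2 := circleOf_eq_iff fun b hb => (h₂.2 b hb).symm
  have g12 := circleOf_eq_iff fun b hb => (h₁₂.2 b hb).symm
  have g21 := circleOf_eq_iff fun b hb => (h₂₁.2 b hb).symm
  unfold Touches at *
  clear h₁ h₂ h₁₂ h₂₁
  generalize (Sum.inl (c, 0) : Dart D.n D.m) = p at *
  generalize (Sum.inl (c, 2) : Dart D.n D.m) = q at *
  generalize (Sum.inl (c', 0) : Dart D.n D.m) = p' at *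
  generalize (Sum.inl (c', 2) : Dart D.n D.m) = q' at *
  generalize circleOf S = s at *
  generalize circleOf S₁ = s₁ at *
  generalize circleOf S₂ = s₂ at *
  generalize circleOf S₁₂ = s₁₂ at *
  -- Two splits, or two merges, in one order force the same in the other. If both orders split and
  -- then merge, or both merge and then split, the half-edges at `c` and those at `c'` finally lie
  -- on the same circles, up to exchange in the last case.
  refine ⟨fun a b => ?_, fun a b => ?_, fun a b c d => ?_, fun a b c d => ?_⟩
  · have h2 : s p' = s q' := (g1 a p' q').2 (Or.inl b)
    refine ⟨h2, by_contra fun n => ?_⟩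
    exact e1.1 ((g12 b p q).2 (Or.inl (e21.2 n))) a
  · have h1 := e1.2 a
    refine ⟨fun h => b ((f1 h1 p' q').2 (Or.inl h)), ?_⟩
    exact fun h => e21.1 ((f12 (e12.2 b) p q).2 (Or.inl h1)) h
  · have h1 := ((g1 a p' q').1 c).resolve_left b
    have h2 := f12 (e12.2 b)
    rw [h2, h2]
    rcases h1 with ⟨h3 | h3, h4 | h4⟩
    · exact absurd (h3.trans h4.symm) b
    · exact ⟨Or.inl h3.symm, Or.inl h4.symm⟩
    · exact ⟨Or.inr ⟨Or.inr h4.symm, Or.inl rfl⟩, Or.inr ⟨Or.inl h3.symm, Or.inr rfl⟩⟩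
    · exact absurd (h3.trans h4.symm) b
  · have h1 := ((g21 d p' q').1 (e2.2 c)).resolve_left fun h => e12.1 h b
    rcases h1 with ⟨h3 | h3, h4 | h4⟩
    · exact absurd (h3.trans h4.symm) fun h => e12.1 h b
    · exact Or.inl ⟨h3.symm, h4.symm⟩
    · exact Or.inr ⟨h4.symm, h3.symm⟩
    · exact absurd (h3.trans h4.symm) fun h => e12.1 h b

/-- The image of a generator with signs `v₊`, in both cases. -/
theorem crossingMap_topGen {S S' : D.Resolution} {c : Fin D.n} (hc : S c = false)
    (hS' : S' = Function.update S c true) :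
    (circleOf S (Sum.inl (c, 0)) ≠ circleOf S (Sum.inl (c, 2)) ∧
      crossingMap R c (topGen R S) = topGen R S') ∨
    (circleOf S (Sum.inl (c, 0)) = circleOf S (Sum.inl (c, 2)) ∧
      crossingMap R c (topGen R S) = lowerMap R (Sum.inl (c, 0)) (topGen R S') +
        lowerMap R (Sum.inl (c, 2)) (topGen R S')) := by
  subst hS'
  by_cases h : circleOf S (Sum.inl (c, 0)) = circleOf S (Sum.inl (c, 2))
  · exact Or.inr ⟨h, crossingMap_topGen_of_split hc h⟩
  · exact Or.inl ⟨h, crossingMap_topGen_of_merge hc h⟩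

theorem crossingMap_topGen_of_true {S : D.Resolution} {c : Fin D.n} (hc : S c = true) :
    crossingMap R c (topGen R S) = 0 := crossingMap_single_of_true hc

theorem crossingMap_crossingMap_topGen_of_true {S : D.Resolution} {c c' : Fin D.n}
    (hc : S c = true) : crossingMap R c (crossingMap R c' (topGen R S)) = 0 := by
  by_cases hc' : S c' = true
  · rw [crossingMap_topGen_of_true hc', map_zero]
  · have h : Function.update S c' true c = true := by
      by_cases h : c = c' <;> simp [Function.update_apply, hc]
    rcases crossingMap_topGen (R := R) (by simpa using hc') rfl with ⟨-, h'⟩ | ⟨-, h'⟩ <;> rw [h']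
    · exact crossingMap_topGen_of_true h
    · rw [map_add, crossingMap_lowerMap, crossingMap_lowerMap, crossingMap_topGen_of_true h,
        map_zero, map_zero, add_zero]

/-- The faces of the cube of resolutions commute on the generators with signs `v₊`. -/
theorem crossingMap_comm_topGen {c c' : Fin D.n} (hne : c ≠ c') (S : D.Resolution) :
    crossingMap R c' (crossingMap R c (topGen R S)) =
      crossingMap R c (crossingMap R c' (topGen R S)) := by
  by_cases hc : S c = true
  · rw [crossingMap_topGen_of_true hc, map_zero, crossingMap_crossingMap_topGen_of_true hc]
  by_cases hc' : S c' = true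
  · rw [crossingMap_topGen_of_true hc', map_zero, crossingMap_crossingMap_topGen_of_true hc']
  rw [Bool.not_eq_true] at hc hc'
  have h1 : Function.update S c true c' = false := by simp [hne.symm, hc']
  have h2 : Function.update S c' true c = false := by simp [hne, hc]
  have hcomm := Function.update_comm hne true true S
  obtain ⟨k1, k2, k3, k4⟩ := square_cases (update_ne_iff hc rfl) (update_ne_iff hc' rfl)
    (update_ne_iff h1 rfl) (update_ne_iff h2 hcomm)
  obtain ⟨l1, l2, -, -⟩ := square_cases (update_ne_iff hc' rfl) (update_ne_iff hc rfl)
    (update_ne_iff h2 hcomm) (update_ne_iff h1 rfl)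
  have m1 := crossingMap_topGen (R := R) hc rfl
  have m2 := crossingMap_topGen (R := R) hc' rfl
  have m12 := crossingMap_topGen (R := R) h1 rfl
  have m21 := crossingMap_topGen (R := R) h2 hcomm
  generalize Function.update S c true = S₁ at *
  generalize Function.update S c' true = S₂ at *
  generalize Function.update S₁ c' true = S₁₂ at *
  -- Of the sixteen patterns of merges and splits, ten are impossible. Three are settled by moving
  -- edge maps past lowering operators: only merges, and one order merging first while the other
  -- splits first. The rest need equal circles, or commuting lowering operators for two splits.
  rcases m1 with ⟨n1, m1⟩ | ⟨n1, m1⟩ <;> rcases m12 with ⟨n12, m12⟩ | ⟨n12, m12⟩ <;>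
    rcases m2 with ⟨n2, m2⟩ | ⟨n2, m2⟩ <;> rcases m21 with ⟨n21, m21⟩ | ⟨n21, m21⟩ <;>
    rw [m1, m2] <;> simp only [map_add, crossingMap_lowerMap, m12, m21]
  · exact absurd n21 (k2 n1 n12).2
  · exact absurd n2 (k2 n1 n12).1
  · exact absurd n2 (k2 n1 n12).1
  · exact absurd n12 (l2 n2 n21).2
  · rcases k4 n1 n12 n2 n21 with ⟨k, k'⟩ | ⟨k, k'⟩
    · rw [lowerMap_topGen_congr k, lowerMap_topGen_congr k']
    · rw [lowerMap_topGen_congr k, lowerMap_topGen_congr k', add_comm]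
  · exact absurd (l1 n2 n21).1 n1
  · exact absurd n1 (l2 n2 n21).1
  · obtain ⟨k, k'⟩ := k3 n1 n12 n2 n21
    rw [lowerMap_topGen_congr k, lowerMap_topGen_congr k']
  · exact absurd (l1 n2 n21).2 n12
  · exact absurd (k1 n1 n12).1 n2
  · exact absurd (k1 n1 n12).1 n2
  · exact absurd (k1 n1 n12).2 n21
  · simp only [lowerMap_comm (Sum.inl (c', _))]
    abel

/-- Both composites commute with the lowering operators, so it suffices to compare them on all-`v₊`
generators. -/
theorem crossingMap_comm {c c' : Fin D.n} (hne : c ≠ c') (v : D.TotalCKh R) :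
    crossingMap R c' (crossingMap R c v) = crossingMap R c (crossingMap R c' v) := by
  suffices h : crossingMap R c' ∘ₗ crossingMap R c = crossingMap R c ∘ₗ crossingMap R c' from
    LinearMap.congr_fun h v
  refine Finsupp.lhom_ext' fun ⟨S, s⟩ => LinearMap.ext_ring ?_
  simp only [LinearMap.comp_apply, Finsupp.lsingle_apply]
  refine single_induction (P := fun v => crossingMap R c' (crossingMap R c v) =
    crossingMap R c (crossingMap R c' v)) S (crossingMap_comm_topGen hne S) ?_ s
  intro d v hv
  simp only [crossingMap_lowerMap, hv]

/-! ### The square of the differential -/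

/-- The sign for changing the crossing `c`. -/
def crossingSign (R : Type u) [CommRing R] (c : Fin D.n) (S : D.Resolution) : R :=
  (-1) ^ Nat.card {i : Fin D.n // i < c ∧ S i = true}

theorem crossingSign_update {c c' : Fin D.n} (hne : c ≠ c') {S : D.Resolution}
    (hc' : S c' = false) :
    crossingSign R c (Function.update S c' true) =
      (if c' < c then -1 else 1) * crossingSign R c S := by
  have hcard : ∀ S : D.Resolution, Nat.card {i : Fin D.n // i < c ∧ S i = true} =
      (Finset.univ.filter fun i => i < c ∧ S i = true).card := fun S => by
    rw [Nat.card_eq_fintype_card, Fintype.card_subtype]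
  rw [crossingSign, crossingSign, hcard, hcard]
  split_ifs with h
  · rw [← pow_succ', ← Finset.card_insert_of_notMem (a := c') (by simp [hc'])]
    congr 2
    ext i
    by_cases hi : i = c'
    · subst hi
      simp [h]
    · simp [hi]
  · rw [one_mul]
    congr 2
    ext i
    by_cases hi : i = c'
    · subst hi
      simp [h]
    · simp [hi]

variable (R) in
/-- The operator that multiplies a generator by the sign for changing the crossing `c`. -/
def signMap (c : Fin D.n) : D.TotalCKh R →ₗ[R] D.TotalCKh R :=
  Finsupp.linearCombination R fun x : D.EnhancedState =>
    Finsupp.single x (crossingSign R c x.1)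

theorem signMap_single (c : Fin D.n) (x : D.EnhancedState) :
    signMap R c (Finsupp.single x 1) = crossingSign R c x.1 • Finsupp.single x 1 := by
  simp [signMap]

theorem signMap_comm (c c' : Fin D.n) (v : D.TotalCKh R) :
    signMap R c (signMap R c' v) = signMap R c' (signMap R c v) := by
  suffices h : signMap R c ∘ₗ signMap R c' = signMap R c' ∘ₗ signMap (D := D) R c from
    LinearMap.congr_fun h v
  refine Finsupp.lhom_ext' fun x => LinearMap.ext_ring ?_
  simp only [LinearMap.comp_apply, Finsupp.lsingle_apply, signMap_single, map_smul]
  rw [smul_comm]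

/-- Changing `c'` adds a `1`-resolution before `c` exactly when `c' < c`. -/
theorem signMap_crossingMap {c c' : Fin D.n} (hne : c ≠ c') (v : D.TotalCKh R) :
    signMap R c (crossingMap R c' v) =
      (if c' < c then -1 else 1 : R) • crossingMap R c' (signMap R c v) := by
  classical
  suffices h : signMap R c ∘ₗ crossingMap R c' =
      (if c' < c then -1 else 1 : R) • (crossingMap R c' ∘ₗ signMap R c) from
    LinearMap.congr_fun h v
  refine Finsupp.lhom_ext' fun x => LinearMap.ext_ring ?_
  simp only [LinearMap.comp_apply, LinearMap.smul_apply, Finsupp.lsingle_apply, signMap_single,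
    map_smul]
  rw [crossingMap_single, map_sum, smul_smul, Finset.smul_sum]
  refine Finset.sum_congr rfl fun y _ => ?_
  split_ifs with h h' <;> try simp
  all_goals
    rw [signMap_single, h.2.1, crossingSign_update hne h.1]
    simp [h']

theorem crossingMap_signMap_crossingMap (c : Fin D.n) (v : D.TotalCKh R) :
    crossingMap R c (signMap R c (crossingMap R c v)) = 0 := by
  classical
  suffices h : crossingMap R c ∘ₗ signMap R c ∘ₗ crossingMap R c = 0 from
    LinearMap.congr_fun h v
  refine Finsupp.lhom_ext' fun x => LinearMap.ext_ring ?_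
  simp only [LinearMap.comp_apply, Finsupp.lsingle_apply]
  rw [crossingMap_single, map_sum, map_sum]
  refine Finset.sum_eq_zero fun y _ => ?_
  split_ifs with h
  · rw [signMap_single, map_smul, crossingMap_single_of_true (by rw [h.2.1]; simp), smul_zero]
  · rw [map_zero, map_zero]

variable (D R) in
/-- The Khovanov differential on the total complex. -/
def totalDiff : D.TotalCKh R →ₗ[R] D.TotalCKh R :=
  Finsupp.linearCombination R fun x : D.EnhancedState =>
    ∑ y : D.EnhancedState, Finsupp.single y (diffCoeff R x y)

theorem totalDiff_single_apply (x y : D.EnhancedState) :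
    totalDiff D R (Finsupp.single x 1) y = diffCoeff R x y := by
  simp [totalDiff, Finsupp.single_apply]

theorem totalDiff_eq (v : D.TotalCKh R) :
    totalDiff D R v = ∑ c, crossingMap R c (signMap R c v) := by
  classical
  suffices h : totalDiff D R = ∑ c, crossingMap R c ∘ₗ signMap R c by
    rw [h, LinearMap.sum_apply]
    rfl
  refine Finsupp.lhom_ext' fun x => LinearMap.ext_ring ?_
  simp only [LinearMap.comp_apply, LinearMap.sum_apply, Finsupp.lsingle_apply]
  ext z
  rw [totalDiff_single_apply, diffCoeff, Finsupp.finsetSum_apply]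
  refine Finset.sum_congr rfl fun c _ => ?_
  rw [signMap_single, map_smul, Finsupp.smul_apply, crossingMap_single_apply]
  split_ifs <;> simp [crossingSign]

/-- The Khovanov differential squares to zero. -/
theorem totalDiff_totalDiff (v : D.TotalCKh R) : totalDiff D R (totalDiff D R v) = 0 := by
  rw [totalDiff_eq, totalDiff_eq]
  simp only [map_sum]
  rw [← Finset.sum_product']
  -- The terms for `(c, c')` and `(c', c)` cancel, since exactly one of `c < c'` and `c' < c`
  -- contributes a sign; the diagonal terms vanish because a crossing cannot be changed twice.
  refine Finset.sum_involution (fun p _ => (p.2, p.1)) ?_ ?_ ?_ ?_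
  · rintro ⟨c, c'⟩ -
    by_cases hne : c = c'
    · subst hne
      simp [crossingMap_signMap_crossingMap]
    · simp only [signMap_crossingMap hne, signMap_crossingMap (Ne.symm hne), map_smul,
        crossingMap_comm hne, signMap_comm c c']
      rcases lt_or_gt_of_ne hne with h | h
      · simp [h, h.not_gt]
      · simp [h, h.not_gt]
  · rintro ⟨c, c'⟩ - h h'
    simp only [Prod.mk.injEq] at h'
    obtain rfl := h'.1
    exact h (crossingMap_signMap_crossingMap _ _)
  · simp
  · simp

end AnnularDiagram

/-- How a sum changes when two terms are replaced by one. -/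
theorem Fintype.sum_add_eq_of_merge {ι κ M : Type*} [Fintype ι] [Fintype κ] [AddCommGroup M]
    {a b : ι} {c : κ} (π : ι → κ) (hab : a ≠ b) (hπ : ∀ x, π x = c ↔ x = a ∨ x = b)
    (hsurj : Function.Surjective π) (hinj : ∀ x y, π x = π y → π x ≠ c → x = y)
    (f : ι → M) (g : κ → M) (hfg : ∀ x, π x ≠ c → f x = g (π x)) :
    ∑ x, f x + g c = ∑ y, g y + (f a + f b) := by
  classical
  have h : ∑ x ∈ (Finset.univ.erase a).erase b, f x = ∑ y ∈ Finset.univ.erase c, g y := by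
    refine Finset.sum_bij (fun x _ => π x) ?_ ?_ ?_ ?_
    · intro x hx
      simp only [Finset.mem_erase, Finset.mem_univ, and_true] at hx ⊢
      exact fun h => ((hπ x).1 h).elim hx.2 hx.1
    · intro x hx y hy hxy
      simp only [Finset.mem_erase, Finset.mem_univ, and_true] at hx hy
      exact hinj x y hxy fun h => ((hπ x).1 h).elim hx.2 hx.1
    · intro y hy
      obtain ⟨x, rfl⟩ := hsurj y
      simp only [Finset.mem_erase, Finset.mem_univ, and_true, ne_eq, hπ, not_or] at hy
      exact ⟨x, by simpa using ⟨hy.2, hy.1⟩, rfl⟩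
    · intro x hx
      simp only [Finset.mem_erase, Finset.mem_univ, and_true] at hx
      exact hfg x fun h => ((hπ x).1 h).elim hx.2 hx.1
  rw [← Finset.add_sum_erase _ _ (Finset.mem_univ a), ← Finset.add_sum_erase _ g (Finset.mem_univ c),
    ← Finset.add_sum_erase _ _ (Finset.mem_erase.2 ⟨hab.symm, Finset.mem_univ b⟩), h]
  abel

namespace AnnularDiagram

variable {D : AnnularDiagram}

open EnhancedState

/-! ### The gradings and the differential -/

/-- How a sum over circles changes when two circles merge. -/
theorem sum_circle_of_merge {S S' : D.Resolution} {c : Fin D.n} (hS : ∀ c', c' ≠ c → S c' = S' c')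
    (h : circleOf S (Sum.inl (c, 0)) ≠ circleOf S (Sum.inl (c, 2)))
    (h' : circleOf S' (Sum.inl (c, 0)) = circleOf S' (Sum.inl (c, 2)))
    (f : Circle S → ℤ) (g : Circle S' → ℤ)
    (hfg : ∀ d, ¬ Touches S c d → f (circleOf S d) = g (circleOf S' d)) :
    ∑ C, f C + g (circleOf S' (Sum.inl (c, 0))) =
      ∑ C, g C + (f (circleOf S (Sum.inl (c, 0))) + f (circleOf S (Sum.inl (c, 2)))) := by
  have hr := circleOf_eq_iff hS h'
  let π : Circle S → Circle S' := Quot.lift (circleOf S') fun d e hde =>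
    (hr d e).2 (Or.inl (Quot.sound hde))
  have hπ : ∀ d, π (circleOf S d) = circleOf S' d := fun _ => rfl
  have hex : ∀ C : Circle S, ∃ d, circleOf S d = C := Quot.mk_surjective
  have hp := touches_crossing S c 0
  have ht : ∀ d, circleOf S' d = circleOf S' (Sum.inl (c, 0)) ↔ Touches S c d := fun d => by
    rw [hr]
    exact ⟨fun h => h.elim Or.inl fun h => h.1, fun h => Or.inr ⟨h, hp⟩⟩
  refine Fintype.sum_add_eq_of_merge π h ?_ ?_ ?_ f g ?_
  · intro C
    obtain ⟨d, rfl⟩ := hex C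
    rw [hπ, ht, Touches]
  · intro C
    obtain ⟨d, rfl⟩ := Quot.mk_surjective C
    exact ⟨circleOf S d, rfl⟩
  · intro C C'
    obtain ⟨d, rfl⟩ := hex C
    obtain ⟨e, rfl⟩ := hex C'
    rw [hπ, hπ, hr, Ne, ht]
    tauto
  · intro C
    obtain ⟨d, rfl⟩ := hex C
    rw [hπ, Ne, ht]
    exact hfg d

/-! ### Homology classes of circles. -/

/-- The indicator function of `C` is invariant under `edge` and `smooth`, hence a boundary; adding a
constant makes it vanish at the outer region. -/
theorem exists_normalized_region_function {S : D.Resolution} (C : Circle S) :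
    ∃ u : Fin D.numRegions → ZMod 2, u D.outer = 0 ∧
      ∀ d, u (D.region d) + u (D.region (D.edge d)) = 1 ↔ circleOf S d = C := by
  classical
  obtain ⟨u, hu⟩ := exists_region_function S (fun d => if circleOf S d = C then 1 else 0)
    (fun d => by simp only [circleOf_edge]) (fun d => by simp only [circleOf_smooth])
  refine ⟨fun r => u r + u D.outer, CharTwo.add_self_eq_zero _, fun d => ?_⟩
  have : u (D.region d) + u D.outer + (u (D.region (D.edge d)) + u D.outer) =
      u (D.region d) + u (D.region (D.edge d)) := by
    rw [add_add_add_comm, CharTwo.add_self_eq_zero, add_zero]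
  rw [this, ← hu]
  by_cases h : circleOf S d = C <;> simp [h]

theorem eq_of_boundary_eq {u v : Fin D.numRegions → ZMod 2} (hu : u D.outer = 0)
    (hv : v D.outer = 0) (h : ∀ d, u (D.region d) + u (D.region (D.edge d)) =
      v (D.region d) + v (D.region (D.edge d))) : u = v := by
  ext r
  have := D.eq_of_region_boundary_eq_zero (u := u + v) (fun d => by
    simp only [Pi.add_apply]
    rw [add_add_add_comm, h, CharTwo.add_self_eq_zero]) r D.outer
  rw [Pi.add_apply, Pi.add_apply, hu, hv, add_zero] at this
  exact CharTwo.add_eq_zero.1 this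

theorem _root_.ZMod.two_eq_of_iff {a b : ZMod 2} (h : a = 1 ↔ b = 1) : a = b := by
  revert a b
  decide

/-- A circle encloses the puncture if the function on the regions whose boundary is the circle
takes different values at the puncture and the outer boundary. -/
theorem homologyClass_eq {S : D.Resolution} {C : Circle S} {u : Fin D.numRegions → ZMod 2}
    (h0 : u D.outer = 0)
    (hu : ∀ d, u (D.region d) + u (D.region (D.edge d)) = 1 ↔ circleOf S d = C) :
    C.homologyClass = (u D.puncture).val := by
  classical
  have key : C.EnclosesPuncture ↔ u D.puncture = 1 := by
    have hxor : ∀ a b : ZMod 2, Xor (a = 1) (b = 1) ↔ a + b = 1 := by decide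
    constructor
    · rintro ⟨U, hp, ho, hU⟩
      have huv : u = fun r => if r ∈ U then 1 else 0 := by
        refine eq_of_boundary_eq h0 (by simp [ho]) fun d => ZMod.two_eq_of_iff ?_
        rw [hu, ← hU, ← hxor]
        simp
      rw [huv]
      simp [hp]
    · intro h
      refine ⟨{r | u r = 1}, h, by simp [h0], fun d => ?_⟩
      rw [← hu, ← hxor]
      rfl
  have h01 : ∀ a : ZMod 2, (a.val : ℤ) = if a = 1 then 1 else 0 := by decide
  rw [h01, Circle.homologyClass]
  exact if_congr key rfl rfl

theorem homologyClass_congr {S S' : D.Resolution} {C : Circle S} {C' : Circle S'}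
    (h : ∀ d, circleOf S d = C ↔ circleOf S' d = C') : C.homologyClass = C'.homologyClass := by
  obtain ⟨u, hu, hu'⟩ := exists_normalized_region_function C
  rw [homologyClass_eq hu hu', homologyClass_eq (C := C') hu fun d => (hu' d).trans (h d)]

/-- The possible homology classes of three circles, two of which merge to the third. -/
theorem homologyClass_of_merge {S S' : D.Resolution} {C₁ C₂ : Circle S} {C : Circle S'}
    (hne : C₁ ≠ C₂) (h : ∀ d, circleOf S' d = C ↔ circleOf S d = C₁ ∨ circleOf S d = C₂) :
    (C₁.homologyClass = 0 ∧ C₂.homologyClass = 0 ∧ C.homologyClass = 0) ∨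
    (C₁.homologyClass = 0 ∧ C₂.homologyClass = 1 ∧ C.homologyClass = 1) ∨
    (C₁.homologyClass = 1 ∧ C₂.homologyClass = 0 ∧ C.homologyClass = 1) ∨
    (C₁.homologyClass = 1 ∧ C₂.homologyClass = 1 ∧ C.homologyClass = 0) := by
  obtain ⟨u, hu, hu'⟩ := exists_normalized_region_function C₁
  obtain ⟨v, hv, hv'⟩ := exists_normalized_region_function C₂
  -- Distinct circles share no edge, so `u + v` bounds their union, which is the merged circle.
  -- Hence classes add mod `2`.
  have hw : ∀ d, (u + v) (D.region d) + (u + v) (D.region (D.edge d)) = 1 ↔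
      circleOf S' d = C := fun d => by
    have hadd : ∀ a b : ZMod 2, a + b = 1 ↔ (a = 1 ∧ b ≠ 1) ∨ (a ≠ 1 ∧ b = 1) := by decide
    rw [Pi.add_apply, Pi.add_apply, add_add_add_comm, hadd, Ne, Ne, hu', hv', h]
    constructor
    · rintro (⟨h, -⟩ | ⟨-, h⟩)
      exacts [Or.inl h, Or.inr h]
    · rintro (h | h)
      · exact Or.inl ⟨h, fun h' => hne (h.symm.trans h')⟩
      · exact Or.inr ⟨fun h' => hne (h'.symm.trans h), h⟩
  rw [homologyClass_eq hu hu', homologyClass_eq hv hv',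
    homologyClass_eq (u := u + v) (by simp [hu, hv]) hw, Pi.add_apply]
  generalize u D.puncture = a
  generalize v D.puncture = b
  revert a b
  decide

/-! ### Change of the degrees under the differential. -/

theorem height_of_occurs {c : Fin D.n} {x y : D.EnhancedState} (h : Occurs c x y) :
    y.height = x.height + 1 := by
  have hcard : ∀ S : D.Resolution, Nat.card {c : Fin D.n // S c = true} =
      (Finset.univ.filter fun c => S c = true).card := fun S => by
    rw [Nat.card_eq_fintype_card, Fintype.card_subtype]
  rw [height, height, hcard, hcard, ← Finset.card_insert_of_notMem (a := c) (by simp [h.1])]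
  congr 1
  ext i
  rw [h.2.1]
  by_cases hi : i = c <;> simp [hi]

theorem homDeg_of_occurs {c : Fin D.n} {x y : D.EnhancedState} (h : Occurs c x y) :
    y.homDeg = x.homDeg + 1 := by
  rw [homDeg, homDeg, height_of_occurs h]
  push_cast
  ring

/-- The sum of the signs of the circles, weighted by `w`. -/
def weightedSum (w : ∀ S : D.Resolution, Circle S → ℤ) (x : D.EnhancedState) : ℤ :=
  ∑ C : Circle x.1, signValue (x.2 C) * w x.1 C

theorem touches_iff_circleOf_eq {S S' : D.Resolution} {c : Fin D.n}
    (hS : ∀ c', c' ≠ c → S c' = S' c')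
    (h' : circleOf S' (Sum.inl (c, 0)) = circleOf S' (Sum.inl (c, 2))) (d : Dart D.n D.m) :
    circleOf S' d = circleOf S' (Sum.inl (c, 0)) ↔ Touches S c d := by
  rw [← touches_iff hS h', Touches, ← h', or_self]

/-- By `hw` the weight depends only on the half-edges of a circle, so circles away from `c`
contribute equally to both sums. -/
theorem weightedSum_of_merge (w : ∀ S : D.Resolution, Circle S → ℤ)
    (hw : ∀ (S S' : D.Resolution) (C : Circle S) (C' : Circle S'),
      (∀ d, circleOf S d = C ↔ circleOf S' d = C') → w S C = w S' C')
    {c : Fin D.n} {x y : D.EnhancedState} (hS : ∀ c', c' ≠ c → x.1 c' = y.1 c')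
    (h : circleOf x.1 (Sum.inl (c, 0)) ≠ circleOf x.1 (Sum.inl (c, 2)))
    (h' : circleOf y.1 (Sum.inl (c, 0)) = circleOf y.1 (Sum.inl (c, 2)))
    (hxy : ∀ d, ¬ Touches x.1 c d → y.sign d = x.sign d) :
    weightedSum w x + signValue (y.sign (Sum.inl (c, 0))) * w _ (circleOf y.1 (Sum.inl (c, 0))) =
      weightedSum w y +
        (signValue (x.sign (Sum.inl (c, 0))) * w _ (circleOf x.1 (Sum.inl (c, 0))) +
          signValue (x.sign (Sum.inl (c, 2))) * w _ (circleOf x.1 (Sum.inl (c, 2)))) := by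
  refine sum_circle_of_merge hS h h' (fun C => signValue (x.2 C) * w x.1 C)
    (fun C => signValue (y.2 C) * w y.1 C) fun d hd => ?_
  have h₁ : x.2 (circleOf x.1 d) = y.2 (circleOf y.1 d) := (hxy d hd).symm
  have h₂ : w x.1 (circleOf x.1 d) = w y.1 (circleOf y.1 d) := hw _ _ _ _ fun e => by
    rw [circleOf_eq_iff hS h' e d]
    tauto
  simp only [h₁, h₂]

/-- The change of a weighted sum of signs under the differential. -/
theorem weightedSum_of_occurs (w : ∀ S : D.Resolution, Circle S → ℤ)
    (hw : ∀ (S S' : D.Resolution) (C : Circle S) (C' : Circle S'),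
      (∀ d, circleOf S d = C ↔ circleOf S' d = C') → w S C = w S' C')
    {c : Fin D.n} {x y : D.EnhancedState} (h : Occurs c x y) :
    (∃ (C₁ C₂ : Circle x.1) (C : Circle y.1), C₁ ≠ C₂ ∧
      (∀ d, circleOf y.1 d = C ↔ circleOf x.1 d = C₁ ∨ circleOf x.1 d = C₂) ∧
      MulRule (x.2 C₁) (x.2 C₂) (y.2 C) ∧
      weightedSum w x + signValue (y.2 C) * w _ C =
        weightedSum w y + (signValue (x.2 C₁) * w _ C₁ + signValue (x.2 C₂) * w _ C₂)) ∨
    (∃ (C₁ C₂ : Circle y.1) (C : Circle x.1), C₁ ≠ C₂ ∧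
      (∀ d, circleOf x.1 d = C ↔ circleOf y.1 d = C₁ ∨ circleOf y.1 d = C₂) ∧
      ComulRule (x.2 C) (y.2 C₁) (y.2 C₂) ∧
      weightedSum w y + signValue (x.2 C) * w _ C =
        weightedSum w x + (signValue (y.2 C₁) * w _ C₁ + signValue (y.2 C₂) * w _ C₂)) := by
  obtain ⟨hx, hy, hxy, hcases⟩ := h
  have hS := (update_ne_iff hx hy).2
  have hS' : ∀ c', c' ≠ c → y.1 c' = x.1 c' := fun c' hc => (hS c' hc).symm
  have hxy' : ∀ d, ¬ Touches x.1 c d → y.sign d = x.sign d := fun d hd =>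
    hxy d (fun h => hd (Or.inl h)) fun h => hd (Or.inr h)
  rcases hcases with ⟨h, h', hm⟩ | ⟨h, h', hm⟩
  · exact Or.inl ⟨_, _, _, h, touches_iff_circleOf_eq hS h', hm,
      weightedSum_of_merge w hw hS h h' hxy'⟩
  -- A split is a merge read backwards, with `x` and `y` exchanged.
  · refine Or.inr ⟨_, _, _, h', touches_iff_circleOf_eq hS' h, hm,
      weightedSum_of_merge w hw hS' h' h fun d hd => (hxy' d fun hd' => hd ?_).symm⟩
    rwa [← touches_iff hS' h]

/-- Both `m` and `Δ` lower the sum of the signs by one, which compensates for the additional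
`1`-resolution. -/
theorem qDeg_of_occurs {c : Fin D.n} {x y : D.EnhancedState} (h : Occurs c x y) :
    y.qDeg = x.qDeg := by
  have hq : ∀ x : D.EnhancedState,
      x.qDeg = weightedSum (fun _ _ => 1) x + (x.height - D.nNeg + D.writhe) := fun x => by
    simp only [qDeg, weightedSum, mul_one]
  have hh := height_of_occurs h
  rw [hq, hq]
  rcases weightedSum_of_occurs (fun _ _ => 1) (fun _ _ _ _ _ => rfl) h with
    ⟨C₁, C₂, C, -, -, hm, hsum⟩ | ⟨C₁, C₂, C, -, -, hm, hsum⟩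
  · rw [mulRule_iff] at hm
    generalize x.2 C₁ = a at *
    generalize x.2 C₂ = b at *
    generalize y.2 C = r at *
    cases a <;> cases b <;> cases r <;> simp [signValue] at hm hsum <;> lia
  · rw [comulRule_iff] at hm
    generalize y.2 C₁ = a at *
    generalize y.2 C₂ = b at *
    generalize x.2 C = r at *
    cases a <;> cases b <;> cases r <;> simp [signValue] at hm hsum <;> lia

/-- Additivity mod `2` leaves four patterns of classes at the crossing; in each one the rules for
`m` and `Δ` are checked. For instance, merging two enclosing circles with `v₊` lowers the degree by
`2`. -/
theorem annDeg_of_occurs {c : Fin D.n} {x y : D.EnhancedState} (h : Occurs c x y) :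
    y.annDeg ≤ x.annDeg := by
  change weightedSum (fun _ C => C.homologyClass) y ≤ weightedSum (fun _ C => C.homologyClass) x
  rcases weightedSum_of_occurs (fun _ C => C.homologyClass)
    (fun _ _ _ _ h => homologyClass_congr h) h with
    ⟨C₁, C₂, C, hne, hC, hm, hsum⟩ | ⟨C₁, C₂, C, hne, hC, hm, hsum⟩
  · have hc := homologyClass_of_merge hne hC
    rw [mulRule_iff] at hm
    generalize x.2 C₁ = a at *
    generalize x.2 C₂ = b at *
    generalize y.2 C = r at *
    rcases hc with ⟨h₁, h₂, h₃⟩ | ⟨h₁, h₂, h₃⟩ | ⟨h₁, h₂, h₃⟩ | ⟨h₁, h₂, h₃⟩ <;>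
      simp only [h₁, h₂, h₃] at hsum <;>
      cases a <;> cases b <;> cases r <;> simp [signValue] at hm hsum <;> lia
  · have hc := homologyClass_of_merge hne hC
    rw [comulRule_iff] at hm
    generalize y.2 C₁ = a at *
    generalize y.2 C₂ = b at *
    generalize x.2 C = r at *
    rcases hc with ⟨h₁, h₂, h₃⟩ | ⟨h₁, h₂, h₃⟩ | ⟨h₁, h₂, h₃⟩ | ⟨h₁, h₂, h₃⟩ <;>
      simp only [h₁, h₂, h₃] at hsum <;>
      cases a <;> cases b <;> cases r <;> simp [signValue] at hm hsum <;> lia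

theorem exists_occurs_of_diffCoeff_ne_zero {R : Type u} [CommRing R] {x y : D.EnhancedState}
    (h : diffCoeff R x y ≠ 0) : ∃ c, Occurs c x y := by
  classical
  by_contra hn
  rw [not_exists] at hn
  exact h (Finset.sum_eq_zero fun c _ => if_neg (hn c))

end AnnularDiagram

namespace AnnularDiagram

variable (D : AnnularDiagram) (R : Type u) [CommRing R]

open EnhancedState

/-! ### The annular filtration on the total complex -/

/-- The filtration of the total complex, in each bidegree. -/
def totalFilt (i j k : ℤ) : Submodule R (D.TotalCKh R) :=
  Finsupp.supported R R {x : D.EnhancedState | x.homDeg = i ∧ x.qDeg = j ∧ x.annDeg ≤ k}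

variable {D R} in
theorem totalDiff_mem_totalFilt {i j k : ℤ} {v : D.TotalCKh R} (hv : v ∈ D.totalFilt R i j k) :
    totalDiff D R v ∈ D.totalFilt R (i + 1) j k := by
  rw [totalFilt, Finsupp.supported_eq_span_single] at hv
  induction hv using Submodule.span_induction with
  | mem v hv =>
    obtain ⟨x, ⟨hi, hj, hk⟩, rfl⟩ := hv
    refine (Finsupp.mem_supported' R _).2 fun y hy => ?_
    rw [totalDiff_single_apply]
    by_contra hne
    obtain ⟨c, hc⟩ := exists_occurs_of_diffCoeff_ne_zero hne
    exact hy ⟨by rw [homDeg_of_occurs hc, hi], by rw [qDeg_of_occurs hc, hj],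
      (annDeg_of_occurs hc).trans hk⟩
  | zero => simp
  | add v w _ _ hv hw => simpa using add_mem hv hw
  | smul a v _ hv => simpa using Submodule.smul_mem _ a hv

/-- The total Khovanov complex with its gradings and the annular filtration. -/
def trigradedFiltration : TrigradedFiltration R (D.TotalCKh R) where
  d := totalDiff D R
  d_d := totalDiff_totalDiff
  F := D.totalFilt R
  mono _ _ _ _ h := Finsupp.supported_mono fun _ hx => ⟨hx.1, hx.2.1, hx.2.2.trans h⟩
  map_d _ _ _ _ hx := totalDiff_mem_totalFilt hx

/-! ### The bigraded pieces inside the total complex. -/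

/-- The inclusion of `CKh^{i,j}(D)` into the total complex. -/
def inclusion (i j : ℤ) : D.CKh R i j →ₗ[R] D.TotalCKh R := Finsupp.lmapDomain R R Subtype.val

variable {D R}

theorem inclusion_injective (i j : ℤ) : Function.Injective (D.inclusion R i j) :=
  Finsupp.mapDomain_injective Subtype.val_injective

theorem inclusion_apply {i j : ℤ} (v : D.CKh R i j) (x : D.Gen i j) :
    D.inclusion R i j v x.1 = v x := Finsupp.mapDomain_apply Subtype.val_injective v x

theorem inclusion_apply_of_not {i j : ℤ} (v : D.CKh R i j) {x : D.EnhancedState}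
    (h : ¬ (x.homDeg = i ∧ x.qDeg = j)) : D.inclusion R i j v x = 0 :=
  Finsupp.mapDomain_of_notMem_range v x (by simpa using h)

theorem inclusion_mem_totalFilt_iff {i j : ℤ} (k : ℤ) (v : D.CKh R i j) :
    D.inclusion R i j v ∈ D.totalFilt R i j k ↔ v ∈ D.filt R i j k := by
  rw [totalFilt, filt, Finsupp.mem_supported', Finsupp.mem_supported']
  constructor
  · intro h x hx
    rw [← inclusion_apply]
    exact h _ fun hx' => hx hx'.2.2
  · intro h x hx
    by_cases hij : x.homDeg = i ∧ x.qDeg = j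
    · exact (inclusion_apply v ⟨x, hij⟩).trans (h _ fun hx' => hx ⟨hij.1, hij.2, hx'⟩)
    · exact inclusion_apply_of_not v hij

theorem totalFilt_le_range (i j k : ℤ) :
    D.totalFilt R i j k ≤ LinearMap.range (D.inclusion R i j) := by
  intro v hv
  refine ⟨v.comapDomain Subtype.val Subtype.val_injective.injOn,
    Finsupp.mapDomain_comapDomain _ Subtype.val_injective _ fun x hx => ?_⟩
  have := (Finsupp.mem_supported R v).1 hv hx
  exact ⟨⟨x, this.1, this.2.1⟩, rfl⟩

theorem diff_single_apply {i i' j : ℤ} (x : D.Gen i j) (y : D.Gen i' j) :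
    D.diff R i i' j (Finsupp.single x 1) y = diffCoeff R x.1 y.1 := by
  classical
  simp [diff, Finsupp.single_apply]

theorem totalDiff_inclusion {i i' j : ℤ} (h : i + 1 = i') (v : D.CKh R i j) :
    totalDiff D R (D.inclusion R i j v) = D.inclusion R i' j (D.diff R i i' j v) := by
  suffices hc : totalDiff D R ∘ₗ D.inclusion R i j = D.inclusion R i' j ∘ₗ D.diff R i i' j from
    LinearMap.congr_fun hc v
  refine Finsupp.lhom_ext' fun x => LinearMap.ext_ring ?_
  simp only [LinearMap.comp_apply, Finsupp.lsingle_apply]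
  have hx : D.inclusion R i j (Finsupp.single x 1) = Finsupp.single x.1 1 :=
    Finsupp.mapDomain_single
  ext y
  rw [hx, totalDiff_single_apply]
  by_cases hij : y.homDeg = i' ∧ y.qDeg = j
  · exact ((inclusion_apply _ ⟨y, hij⟩).trans (diff_single_apply x ⟨y, hij⟩)).symm
  · rw [inclusion_apply_of_not _ hij]
    by_contra hne
    obtain ⟨c, hc⟩ := exists_occurs_of_diffCoeff_ne_zero hne
    exact hij ⟨by rw [homDeg_of_occurs hc, x.2.1, h], by rw [qDeg_of_occurs hc, x.2.2]⟩

theorem diff_eq_zero {i i' j : ℤ} (h : i + 1 ≠ i') : D.diff R i i' j = 0 := by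
  refine Finsupp.lhom_ext' fun x => LinearMap.ext_ring ?_
  ext y
  refine (diff_single_apply x y).trans ?_
  by_contra hne
  obtain ⟨c, hc⟩ := exists_occurs_of_diffCoeff_ne_zero hne
  exact h (by rw [← x.2.1, ← y.2.1, homDeg_of_occurs hc])

theorem diff_comp_diff (i i' i'' j : ℤ) : D.diff R i' i'' j ∘ₗ D.diff R i i' j = 0 := by
  by_cases h : i + 1 = i'
  · by_cases h' : i' + 1 = i''
    · refine LinearMap.ext fun v => inclusion_injective _ _ ?_
      rw [LinearMap.comp_apply, ← totalDiff_inclusion h', ← totalDiff_inclusion h,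
        totalDiff_totalDiff, LinearMap.zero_apply, map_zero]
    · rw [diff_eq_zero h', LinearMap.zero_comp]
  · rw [diff_eq_zero h, LinearMap.comp_zero]

theorem diff_mem_filt {i i' j k : ℤ} {v : D.CKh R i j} (hv : v ∈ D.filt R i j k) :
    D.diff R i i' j v ∈ D.filt R i' j k := by
  by_cases h : i + 1 = i'
  · rw [← inclusion_mem_totalFilt_iff, ← totalDiff_inclusion h, ← h]
    exact totalDiff_mem_totalFilt ((inclusion_mem_totalFilt_iff k v).2 hv)
  · rw [diff_eq_zero h, LinearMap.zero_apply]
    exact zero_mem _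

variable (D) in
theorem exists_annDeg_bounds : ∃ l u : ℤ, ∀ x : D.EnhancedState, l < x.annDeg ∧ x.annDeg ≤ u := by
  obtain ⟨u, hu⟩ := (Set.finite_range fun x : D.EnhancedState => x.annDeg).bddAbove
  obtain ⟨l, hl⟩ := (Set.finite_range fun x : D.EnhancedState => x.annDeg).bddBelow
  -- The shift to `l - 1` makes the lower bound strict, so that the filtration vanishes at that
  -- step.
  exact ⟨l - 1, u, fun x => ⟨by linarith [hl ⟨x, rfl⟩], hu ⟨x, rfl⟩⟩⟩

theorem trigradedFiltration_bounded {l u : ℤ}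
    (h : ∀ x : D.EnhancedState, l < x.annDeg ∧ x.annDeg ≤ u) :
    (D.trigradedFiltration R).Bounded l u := by
  refine ⟨fun i j k hk => ?_, fun i j k hk => ?_⟩
  · refine (congrArg (Finsupp.supported R R) ?_).trans Finsupp.supported_empty
    ext x
    have := (h x).1
    simp only [Set.mem_ofPred_eq, Set.mem_empty_iff_false, iff_false]
    lia
  · refine congrArg (Finsupp.supported R R) ?_
    ext x
    have := (h x).2
    simp only [Set.mem_ofPred_eq]
    lia

theorem filt_eq_bot {l u : ℤ} (h : ∀ x : D.EnhancedState, l < x.annDeg ∧ x.annDeg ≤ u)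
    (i j : ℤ) : D.filt R i j l = ⊥ := by
  refine (congrArg (Finsupp.supported R R) ?_).trans Finsupp.supported_empty
  ext x
  simp [(h x.1).1]

theorem filt_eq_top {l u : ℤ} (h : ∀ x : D.EnhancedState, l < x.annDeg ∧ x.annDeg ≤ u)
    (i j : ℤ) : D.filt R i j u = ⊤ := by
  refine (congrArg (Finsupp.supported R R) ?_).trans (Finsupp.supported_univ)
  ext x
  simp [(h x.1).2]

theorem filt_mono (i j : ℤ) : Monotone (D.filt R i j) := fun _ _ hk =>
  Finsupp.supported_mono fun _ hx => le_trans hx hk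

theorem khFilt_mono (i j : ℤ) : Monotone (D.khFilt R i j) := fun _ _ hk =>
  Submodule.map_mono fun _ hx => filt_mono i j hk hx

end AnnularDiagram

end

/-! ### Assembly of the theorem. -/

theorem mainTheorem7 (R : Type u) [CommRing R] (D : AnnularDiagram) :
    (∀ i i' i'' j : ℤ, D.diff R i' i'' j ∘ₗ D.diff R i i' j = 0) ∧
    (∀ i i' j k : ℤ, ∀ x ∈ D.filt R i j k, D.diff R i i' j x ∈ D.filt R i' j k) ∧
    ∃ E : TrigradedSpectralSequence R,
      (∀ i j k : ℤ, Nonempty ((E.page 1).X (i, j, k) ≃ₗ[R] D.AKh R i j k)) ∧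
      E.ConvergesTo (D.khFilt R) := by
  obtain ⟨l, u, hlu⟩ := D.exists_annDeg_bounds
  have hb := AnnularDiagram.trigradedFiltration_bounded (R := R) hlu
  -- Once `r > u - l`, each differential starts or ends outside the range of the filtration; the
  -- maximum with `1` is there because pages start at `1`.
  refine ⟨AnnularDiagram.diff_comp_diff, fun i i' j k x => AnnularDiagram.diff_mem_filt,
    (D.trigradedFiltration R).spectralSequence, fun i j k => ?_, fun i j => ⟨?_, ⟨l, ?_⟩, u, ?_⟩,
    max 1 (u - l + 1), le_max_left _ _, fun r hr => ⟨fun p p' => ?_, fun i j k => ?_⟩⟩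
  · exact (D.trigradedFiltration R).nonempty_E_one_equiv
      (AnnularDiagram.totalDiff_inclusion (sub_add_cancel i 1))
      (AnnularDiagram.totalDiff_inclusion rfl)
      AnnularDiagram.inclusion_mem_totalFilt_iff (AnnularDiagram.totalFilt_le_range _ _)
      AnnularDiagram.inclusion_mem_totalFilt_iff (AnnularDiagram.totalFilt_le_range _ _)
      AnnularDiagram.inclusion_mem_totalFilt_iff k
  · exact AnnularDiagram.khFilt_mono i j
  · rw [eq_bot_iff]
    rintro _ ⟨x, hx, rfl⟩
    have hx' : (x : D.CKh R i j) ∈ D.filt R i j l := hx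
    rw [AnnularDiagram.filt_eq_bot hlu, Submodule.mem_bot] at hx'
    rw [show x = 0 from Subtype.ext hx', map_zero]
    exact zero_mem _
  · rw [eq_top_iff]
    intro y _
    obtain ⟨x, rfl⟩ := Submodule.Quotient.mk_surjective _ y
    refine ⟨x, ?_, rfl⟩
    change (x : D.CKh R i j) ∈ D.filt R i j u
    rw [AnnularDiagram.filt_eq_top hlu]
    exact Submodule.mem_top
  · refine ModuleCat.hom_ext ?_
    exact hb.dE_eq_zero (by lia) _ _ _ _ _ _
  -- Here `khFilt` unfolds to `homologyFilt` of the bigraded differentials.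
  · exact hb.nonempty_E_equiv (by lia)
      (AnnularDiagram.totalDiff_inclusion (sub_add_cancel i 1))
      (AnnularDiagram.totalDiff_inclusion rfl)
      (AnnularDiagram.inclusion_injective _ _) (AnnularDiagram.inclusion_injective _ _)
      (fun x => ⟨u, (AnnularDiagram.inclusion_mem_totalFilt_iff u x).2 (by
        rw [AnnularDiagram.filt_eq_top hlu]
        exact Submodule.mem_top)⟩) (AnnularDiagram.totalFilt_le_range _ _)
      AnnularDiagram.inclusion_mem_totalFilt_iff (AnnularDiagram.totalFilt_le_range _ _) k
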